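/- **Setting.** There are $n\ge1$ students and $m\ge1$ schools $u$ with capacities $C_u\in\mathbb N$. Each student reports a preference list (distinct schools in decreasing order of preference; being unmatched, $\odot$, is preferred to every unlisted school), and has an integer score in $\{0,\dots,J\}$, $J\ge1$, at each school. A database $D$ consists of the records (list and scores) of all students; two databases are neighbouring if they differ in at most one record. Thresholds $t=(t_u)_u$ induce the matching $\mu^t$ in which every student goes to the first school on her list at which her score is at least $t_u$ (and is unmatched if there is none). *Stability.* A matching $\mu$ is feasible and $\alpha$-approximately stable if students are matched only to schools on their lists, $|\mu^{-1}(u)|\le C_u$ for all $u$, and: (a) whenever $\mu(a)\ne u$, either $a$ strictly prefers $\mu(a)$ to $u$ or every student in $\mu^{-1}(u)$ has a higher score at $u$ than $a$; (b) if $|\mu^{-1}(u)|<(1-\alpha)C_u$, then every student $a$ has $\mu(a)=u$ or strictly prefers $\mu(a)$ to $u$. It is exactly stable if this holds with $\alpha=0$. The school-optimal matching is the exactly stable matching that every school weakly prefers to every exactly stable matching $\nu$, i.e. for every score level it enrols at least as many students at or above that level as $\nu$ does. A matching $\mu$ is school-dominant if, with $\mu'$ the school-optimal matching, for every $u$ each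 student in $\mu(u)\setminus\mu'(u)$ has a higher score at $u$ than each student in $\mu'(u)\setminus\mu(u)$. *Privacy and truthfulness.* A randomized mechanism $M$ from databases to thresholds is $(\varepsilon,\delta)$-differentially private if $\Pr[M(D)\in S]\le e^{\varepsilon}\Pr[M(D')\in S]+\delta$ for all neighbouring $D,D'$ and all sets $S$ of thresholds. It is $\eta$-approximately (dominant strategy) truthful for the students if for every $D$, every student $a$, every utility $v$ on schools and $\odot$ with values in $[0,1]$ that is consistent with $a$'s true list ($v(x)\ge v(y)$ whenever $x$ is preferred to $y$), and every list reported by $a$ in its place, giving the database $D'$, one has $\mathbb E\,v(\mu^{M(D)}(a))\ge\mathbb E\,v(\mu^{M(D')}(a))-\eta$, where $\mu^{M(D')}$ is induced using the reported data $D'$. *The algorithm.* Private DA with parameters $\varepsilon_0,\delta$ (and failure probability $\beta$) puts $T=mnJ$, $\varepsilon'=\varepsilon_0/(16\sqrt{2m\ln(1/\delta)})$ and $E=\frac{128\sqrt{m\ln(1/\delta)}}{\varepsilon_0}\ln\left(\frac{2m}{\beta}\right)\left(\sqrt{\log_2(nT)}\right)^5$. For each school it runs a binary-mechanism counter over $nT$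 time steps: at time $t$, with $i$ the position of the lowest nonzero binary digit of $t$, the counter forms the sum of the last $2^i$ symbols of its stream, adds independent Laplace noise of scale $\log_2(nT)/\varepsilon'$, and outputs the total of the stored noisy sums that belong to the nonzero binary digits of $t$. Initially all thresholds are $J$, all students are unmatched and all counters are $0$. While there is a school $u$ with $\mathrm{counter}(u)<C_u-E$ and $t_u>0$, one such school (chosen by any fixed rule that looks at the current thresholds and the set of such schools) lowers $t_u$ by $1$; then each student in turn moves to her favourite school on her list whose threshold her score reaches, sending $+1$ to the counter of the school she joins, $-1$ to that of the school she leaves and $0$ to all others (and $0$ to all counters if she does not move). Students who have already accepted $k$ proposals are ignored. The output is the final thresholds. **Theorem.** There are universal constants $c>0$ and $d\in\mathbb N$ such that the following holds for all $n,m,J,k\ge1$, $0<\varepsilon\le1$, $0<\delta\le\frac12$, $0<\beta<1$ and all capacities. Run private DA with privacy parameters $\varepsilon_0=\frac{\varepsilon\sqrt m}{2\sqrt k}$ and $\delta$. It is $(\varepsilon,\delta)$-differentially private, and it is $(\varepsilon+\delta)$-approximately truthful for the students. If moreover $0<\alpha\le1$, every student's preference list has length at most $k$, the scores at each school are pairwise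 distinct, and every school satisfies $$C_u\ \ge\ c\,\frac{\sqrt k}{\alpha\varepsilon}\,\left(\ln\frac{nmJ}{\delta\beta}\right)^{d},$$ then with probability at least $1-\beta$ the thresholds that it outputs induce a feasible, $\alpha$-approximately stable and school-dominant matching. (For $J$ polynomially bounded in $n$ and $m$ the condition reads $C_u=\Omega\left(\frac{\sqrt k}{\alpha\varepsilon}\,\mathrm{polylog}(n,m,\frac1\delta,\frac1\beta)\right)$.) -/

import Mathlib

open MeasureTheory

noncomputable section

namespace PrivateMatching

/-! ### Markets -/

/-- The record of one student in a market with `m` schools and integer scores in `[0, J]`: a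
preference list (distinct schools, most preferred first; a student prefers being unmatched to every
school that is not on the list) and the scores that the schools give to the student. -/
structure Student (m J : ℕ) where
  pref : {l : List (Fin m) // l.Nodup}
  score : Fin m → Fin (J + 1)

/-- The data of `n` students. -/
abbrev Database (n m J : ℕ) := Fin n → Student m J

/-- A matching; `none` stands for "unmatched". -/
abbrev Matching (n m : ℕ) := Fin n → Option (Fin m)

/-- Position of an outcome in the ranking given by a preference list: the listed schools in order,
then being unmatched, then all unlisted schools. -/
def prefRank {m : ℕ} (p : {l : List (Fin m) // l.Nodup}) : Option (Fin m) → ℕ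
  | none => p.1.length
  | some u => if u ∈ p.1 then p.1.idxOf u else p.1.length + 1

/-- `Prefers p x y`: the outcome `x` is strictly preferred to `y`. -/
def Prefers {m : ℕ} (p : {l : List (Fin m) // l.Nodup}) (x y : Option (Fin m)) : Prop :=
  prefRank p x < prefRank p y

/-- Each school's scores are pairwise distinct (so they are a strict ranking of the students). -/
def UniqueScores {n m J : ℕ} (D : Database n m J) : Prop :=
  ∀ u : Fin m, Function.Injective fun a : Fin n => (D a).score u

/-- The most preferred school on the student's list whose threshold does not exceed the student's
score there (`none` if there is no such school). -/
def choice {m J : ℕ} (s : Student m J) (t : Fin m → ℕ) : Option (Fin m) :=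
  s.pref.1.find? fun u => decide (t u ≤ (s.score u : ℕ))

/-- The matching induced by the thresholds `t`. -/
def inducedMatching {n m J : ℕ} (D : Database n m J) (t : Fin m → ℕ) : Matching n m :=
  fun a => choice (D a) t

/-- The students matched to the school `u`. -/
def enrolled {n m : ℕ} (μ : Matching n m) (u : Fin m) : Finset (Fin n) :=
  Finset.univ.filter fun a => μ a = some u

/-- Feasible and `α`-approximately stable matchings with respect to the capacities `C`. Every
student is acceptable to every school. -/
structure IsApproxStable {n m J : ℕ} (α : ℝ) (C : Fin m → ℕ) (D : Database n m J)
    (μ : Matching n m) : Prop where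
  /-- no student is matched to a school to which being unmatched is preferred -/
  individuallyRational : ∀ a u, μ a = some u → u ∈ (D a).pref.1
  feasible : ∀ u, (enrolled μ u).card ≤ C u
  /-- no blocking pairs with filled seats -/
  noBlockingFilled : ∀ a u, μ a ≠ some u →
    Prefers (D a).pref (μ a) (some u) ∨ ∀ a' ∈ enrolled μ u, (D a).score u < (D a').score u
  /-- no blocking pairs with empty seats at under-enrolled schools -/
  noBlockingEmpty : ∀ u, ((enrolled μ u).card : ℝ) < (1 - α) * (C u : ℝ) →
    ∀ a, μ a = some u ∨ Prefers (D a).pref (μ a) (some u)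

/-- The school-optimal exactly stable matching: every school weakly prefers it to every stable
matching `ν`, in the sense that for each score level `s` it enrols at least as many students of
score at least `s` as in `ν` (that is, under every responsive extension of its ranking). -/
structure IsSchoolOptimal {n m J : ℕ} (C : Fin m → ℕ) (D : Database n m J)
    (μ : Matching n m) : Prop where
  stable : IsApproxStable 0 C D μ
  optimal : ∀ ν : Matching n m, IsApproxStable 0 C D ν → ∀ (u : Fin m) (s : ℕ),
    ((enrolled ν u).filter fun a => s ≤ ((D a).score u : ℕ)).card ≤
      ((enrolled μ u).filter fun a => s ≤ ((D a).score u : ℕ)).card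

/-- School-dominant matchings. -/
def SchoolDominant {n m J : ℕ} (C : Fin m → ℕ) (D : Database n m J) (μ : Matching n m) : Prop :=
  ∃ μ' : Matching n m, IsSchoolOptimal C D μ' ∧
    ∀ u, ∀ a ∈ enrolled μ u \ enrolled μ' u, ∀ a' ∈ enrolled μ' u \ enrolled μ u,
      (D a').score u < (D a).score u

/-! ### Privacy and truthfulness -/

/-- Two databases that differ in at most one student's record. -/
def Neighboring {n m J : ℕ} (D D' : Database n m J) : Prop :=
  ∃ a : Fin n, ∀ b, b ≠ a → D b = D' b

/-- `(ε, δ)`-differential privacy of a mechanism `M` (given by its output laws). -/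
def IsDifferentiallyPrivate {n m J : ℕ} (M : Database n m J → Measure (Fin m → ℕ))
    (ε δ : ℝ) : Prop :=
  ∀ D D' : Database n m J, Neighboring D D' → ∀ S : Set (Fin m → ℕ),
    M D S ≤ ENNReal.ofReal (Real.exp ε) * M D' S + ENNReal.ofReal δ

/-- `v` is a `[0, 1]`-valued cardinal utility consistent with the preference list `p`. Ties in `v`
are allowed, and nothing is asked of `v` among unlisted schools. -/
def ConsistentUtility {m : ℕ} (p : {l : List (Fin m) // l.Nodup}) (v : Option (Fin m) → ℝ) : Prop :=
  (∀ x, 0 ≤ v x ∧ v x ≤ 1) ∧ ∀ x y, Prefers p x y → v y ≤ v x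

/-- The database in which student `a` reports the preference list `p` instead of her own. -/
def misreport {n m J : ℕ} (D : Database n m J) (a : Fin n) (p : {l : List (Fin m) // l.Nodup}) :
    Database n m J :=
  Function.update D a { pref := p, score := (D a).score }

/-- The mechanism that draws thresholds `t` from `M` and outputs the matching induced by `t` and the
reported data is `η`-approximately dominant strategy truthful for the students. -/
def IsApproxTruthful {n m J : ℕ} (M : Database n m J → Measure (Fin m → ℕ)) (η : ℝ) : Prop :=
  ∀ (D : Database n m J) (a : Fin n) (v : Option (Fin m) → ℝ), ConsistentUtility (D a).pref v →
    ∀ p : {l : List (Fin m) // l.Nodup},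
      (∫ t, v (inducedMatching (misreport D a p) t a) ∂(M (misreport D a p))) - η ≤
        ∫ t, v (inducedMatching D t a) ∂(M D)

/-! ### The binary mechanism for streaming counters -/

/-- The centred Laplace distribution with scale `b`; for `b = 0` it is the point mass at `0`. -/
def laplace (b : ℝ) : Measure ℝ :=
  if 0 < b then
    volume.withDensity fun x => ENNReal.ofReal (1 / (2 * b) * Real.exp (-(|x| / b)))
  else Measure.dirac 0

/-- State of a counter: number of symbols read, partial sums, noisy partial sums. -/
structure Counter where
  time : ℕ
  partialSum : ℕ → ℤ
  noisySum : ℕ → ℝ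

def Counter.init : Counter where
  time := 0
  partialSum := fun _ => 0
  noisySum := fun _ => 0

/-- Reading the symbol `σ` with fresh noise `y`. The index `i` is the position of the lowest nonzero
binary digit of the new time. -/
def Counter.read (c : Counter) (σ : ℤ) (y : ℝ) : Counter :=
  let i := padicValNat 2 (c.time + 1)
  let x : ℤ := (∑ j ∈ Finset.range i, c.partialSum j) + σ
  { time := c.time + 1
    partialSum := fun j => if j < i then 0 else if j = i then x else c.partialSum j
    noisySum := fun j => if j < i then 0 else if j = i then (x : ℝ) + y else c.noisySum j }

/-- The released estimate: the sum of the noisy partial sums over the nonzero binary digits of the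
time. -/
def Counter.value (c : Counter) : ℝ :=
  ∑ i ∈ (Finset.range c.time.size).filter (fun i => c.time.testBit i = true), c.noisySum i

/-! ### Private deferred acceptance -/

/-- A rule by which the algorithm picks the next school to lower its threshold, from the current
thresholds and the nonempty set of under-enrolled schools. -/
structure SelectionRule (m : ℕ) where
  pick : (Fin m → ℕ) → Finset (Fin m) → Fin m
  pick_mem : ∀ t S, S.Nonempty → pick t S ∈ S

structure DAState (n m : ℕ) where
  threshold : Fin m → ℕ
  matching : Matching n m
  /-- the number of proposals that each student has accepted -/
  accepted : Fin n → ℕ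
  counter : Fin m → Counter

def DAState.init (n m J : ℕ) : DAState n m where
  threshold := fun _ => J
  matching := fun _ => none
  accepted := fun _ => 0
  counter := fun _ => Counter.init

/-- Student `a` is processed: unless she has already accepted `k` proposals, she moves to her
favourite school among those whose threshold she passes. Each counter reads exactly one symbol:
`1` at the school she joins, `-1` at the school she leaves, `0` otherwise. -/
def DAState.processStudent {n m J : ℕ} (k : ℕ) (D : Database n m J) (noise : ℕ → Fin m → ℝ)
    (s : DAState n m) (a : Fin n) : DAState n m :=
  open Classical in
  let w := choice (D a) s.threshold
  let moves : Prop := s.accepted a < k ∧ s.matching a ≠ w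
  { threshold := s.threshold
    matching := if moves then Function.update s.matching a w else s.matching
    accepted := if moves then Function.update s.accepted a (s.accepted a + 1) else s.accepted
    counter := fun j => (s.counter j).read
      (if moves then (if w = some j then 1 else if s.matching a = some j then -1 else 0) else 0)
      (noise (s.counter j).time j) }

/-- The under-enrolled schools, with `E` seats of each school held in reserve. -/
def DAState.underEnrolled {n m : ℕ} (C : Fin m → ℕ) (E : ℝ) (s : DAState n m) : Finset (Fin m) :=
  open Classical in
  Finset.univ.filter fun u => (s.counter u).value < (C u : ℝ) - E ∧ 0 < s.threshold u

/-- One pass through the while loop (the identity once the loop has ended). -/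
def DAState.step {n m J : ℕ} (k : ℕ) (sel : SelectionRule m) (C : Fin m → ℕ) (E : ℝ)
    (D : Database n m J) (noise : ℕ → Fin m → ℝ) (s : DAState n m) : DAState n m :=
  open Classical in
  if (s.underEnrolled C E).Nonempty then
    let u := sel.pick s.threshold (s.underEnrolled C E)
    (List.finRange n).foldl (DAState.processStudent k D noise)
      { s with threshold := Function.update s.threshold u (s.threshold u - 1) }
  else s

/-- The final thresholds as a function of the noise. Each pass lowers one of the `m` thresholds,
which start at `J`, so the while loop ends within `m * J` passes. -/
def runDA {n m J : ℕ} (k : ℕ) (sel : SelectionRule m) (C : Fin m → ℕ) (E : ℝ)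
    (D : Database n m J) (noise : ℕ → Fin m → ℝ) : Fin m → ℕ :=
  ((DAState.step k sel C E D noise)^[m * J] (DAState.init n m J)).threshold

/-- The length `n * T`, `T = m * n * J`, with which the counters are instantiated. -/
def horizon (n m J : ℕ) : ℕ := n * (m * n * J)

/-- The privacy parameter of each counter in a run with privacy parameters `ε₀`, `δ`. -/
def counterEps (m : ℕ) (ε₀ δ : ℝ) : ℝ := ε₀ / (16 * √(2 * m * Real.log (1 / δ)))

/-- The number `E` of reserved seats in a run with privacy parameters `ε₀`, `δ`. -/
def reserve (n m J : ℕ) (ε₀ δ β : ℝ) : ℝ :=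
  128 * √(m * Real.log (1 / δ)) / ε₀ * Real.log (2 * m / β) *
    √(Real.logb 2 (horizon n m J)) ^ 5

/-- The law of the noise: independent Laplace variables of scale `log₂ (n T) / ε'`, one for each time
and each counter. -/
def noiseLaw (n m J : ℕ) (ε' : ℝ) : Measure (Fin (horizon n m J) → Fin m → ℝ) :=
  Measure.pi fun _ => Measure.pi fun _ => laplace (Real.logb 2 (horizon n m J) / ε')

/-- The noise table read as a function of the time. Times beyond the horizon do not occur: there are
at most `m * J` passes, and each reads `n` symbols. -/
def noiseAt {N m : ℕ} (ω : Fin N → Fin m → ℝ) (t : ℕ) (j : Fin m) : ℝ :=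
  if h : t < N then ω ⟨t, h⟩ j else 0

/-- The law of the thresholds output by private deferred acceptance with privacy parameters
`ε₀`, `δ`, failure probability `β` and at most `k` accepted proposals per student. -/
def privateDA {n m J : ℕ} (k : ℕ) (sel : SelectionRule m) (C : Fin m → ℕ) (ε₀ δ β : ℝ)
    (D : Database n m J) : Measure (Fin m → ℕ) :=
  (noiseLaw n m J (counterEps m ε₀ δ)).map fun ω =>
    runDA k sel C (reserve n m J ε₀ δ β) D (noiseAt ω)

end PrivateMatching

end

/-! Privacy. During a pass the thresholds are fixed, so each student moves according to her own
record and state only, and the data reach the thresholds solely through the counter values at the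
ends of passes. Let two databases differ at student a. The run on the first with noise y is
reproduced exactly by the second with translated noise: to the noise of each dyadic block of each
counter one adds the change, over that block, of the difference of the two loads. These translations
telescope to the load difference whenever a value is released (`releasedNoise_increments`,
`pairRun_snd`). The loads differ only by the seat of a, who moves at most k times in either run, and
on each of the logarithmically many dyadic levels a move falls into at most one block. Hence the
squares of all translations, over all times and schools, sum to at most 8k(log₂ N + 1)
(`sum_sq_noiseShift_le`). The bound has k where a counter-by-counter composition would have m, which
is why the factor √m/√k in ε₀ is affordable.

The price of a translation Δ of Laplace noise of scale b is measured by Hölder's inequality: it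
costs a factor exp(pΔ²/(2b²)) once the integrand is replaced by its L^q norm (`shiftBound_laplace`).
L^q norms iterate, so the exponents add up even though each translation depends on earlier noise
(`ShiftBound.pi`). A suitable p and Young's inequality (`young_bound`) turn the outcome into (ε,
δ)-privacy, for all [0,1]-valued functions of the thresholds.

Truthfulness. For fixed thresholds the true list yields the best attainable outcome
(`le_of_misreport`), so a misreport can gain only through the law of the thresholds, which privacy
controls.

Stability. Stable matchings are induced by clearing thresholds: those positive only at schools that
they fill. Suppose that all counters are accurate up to E. Then a threshold is lowered only at a
school with a free seat; with distinct scores this adds at most one student there, and it never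
crosses clearing thresholds (`Clearing.le_lower`). So capacities hold, and the final thresholds lie
above the greatest clearing ones, which induce the school-optimal matching; this gives dominance. At
termination every school with positive threshold has at least C - 2E ≥ (1 - α)C students
(`runDA_good`). The limit k never binds, because each accepted proposal improves the student's
position on a list of length at most k. A Chernoff bound for sums of few Laplace variables gives the
accuracy with probability 1 - β (`measure_inaccurate_le`). -/

noncomputable section

namespace PrivateMatching

/-! ### Choices and thresholds -/

/-- The outcomes that a student may have under the thresholds `t`. -/
def Available {m J : ℕ} (s : Student m J) (t : Fin m → ℕ) : Set (Option (Fin m)) :=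
  {x | ∀ u, x = some u → u ∈ s.pref.1 ∧ t u ≤ (s.score u : ℕ)}

lemma Available.anti {m J : ℕ} {s : Student m J} {t t' : Fin m → ℕ} (h : t ≤ t') :
    Available s t' ⊆ Available s t :=
  fun _ hx u hu => ⟨(hx u hu).1, (h u).trans (hx u hu).2⟩

lemma choice_mem_available {m J : ℕ} (s : Student m J) (t : Fin m → ℕ) :
    choice s t ∈ Available s t := by
  intro u hu
  unfold choice at hu
  refine ⟨List.mem_of_find?_eq_some hu, ?_⟩
  simpa using List.find?_some hu

lemma exists_find?_idxOf_le {A : Type*} [DecidableEq A] (p : A → Bool) (l : List A) {w : A}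
    (hw : w ∈ l) (hp : p w = true) : ∃ u, l.find? p = some u ∧ l.idxOf u ≤ l.idxOf w := by
  induction l with
  | nil => simp at hw
  | cons x l ih =>
    by_cases hx : p x = true
    · exact ⟨x, by simp [hx], by simp⟩
    · have hxw : x ≠ w := by rintro rfl; exact hx hp
      have hwl : w ∈ l := by
        rcases List.mem_cons.1 hw with h | h
        · exact absurd h.symm hxw
        · exact h
      obtain ⟨u, hu, hle⟩ := ih hwl
      refine ⟨u, by simp [hx, hu], ?_⟩
      have hxu : x ≠ u := by
        rintro rfl
        exact hx (List.find?_some hu)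
      rw [List.idxOf_cons_ne _ hxu, List.idxOf_cons_ne _ hxw]
      omega

lemma prefRank_le_length {m J : ℕ} {s : Student m J} {t : Fin m → ℕ} {x : Option (Fin m)}
    (hx : x ∈ Available s t) : prefRank s.pref x ≤ s.pref.1.length := by
  cases x with
  | none => simp [prefRank]
  | some u =>
    have := (hx u rfl).1
    simpa [prefRank, this] using List.idxOf_le_length

lemma prefRank_choice_le {m J : ℕ} {s : Student m J} {t : Fin m → ℕ} {x : Option (Fin m)}
    (hx : x ∈ Available s t) : prefRank s.pref (choice s t) ≤ prefRank s.pref x := by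
  cases x with
  | none => simpa [prefRank] using prefRank_le_length (choice_mem_available s t)
  | some w =>
    obtain ⟨hw, hs⟩ := hx w rfl
    obtain ⟨u, hu, hle⟩ := exists_find?_idxOf_le
      (fun u => decide (t u ≤ (s.score u : ℕ))) s.pref.1 hw (by simpa using hs)
    have hu' : choice s t = some u := hu
    have hmem : u ∈ s.pref.1 := List.mem_of_find?_eq_some hu
    rw [hu']
    simpa [prefRank, hw, hmem] using hle

/-- All unlisted schools share one rank, so injectivity needs the restriction to available outcomes.
The thresholds may differ because only membership in the list matters. -/
lemma prefRank_inj {m J : ℕ} {s : Student m J} {t t' : Fin m → ℕ} {x y : Option (Fin m)}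
    (hx : x ∈ Available s t) (hy : y ∈ Available s t')
    (h : prefRank s.pref x = prefRank s.pref y) : x = y := by
  cases x with
  | none =>
    cases y with
    | none => rfl
    | some v =>
      have := (hy v rfl).1
      have hlt := List.idxOf_lt_length_of_mem this
      simp [prefRank, this] at h
      omega
  | some u =>
    have hu := (hx u rfl).1
    have hlt := List.idxOf_lt_length_of_mem hu
    cases y with
    | none => simp [prefRank, hu] at h; omega
    | some v =>
      have hv := (hy v rfl).1
      simp only [prefRank, hu, hv, if_true] at h
      rw [(List.idxOf_inj hu).1 h]

lemma choice_eq_of_forall_le {m J : ℕ} {s : Student m J} {t : Fin m → ℕ} {x : Option (Fin m)}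
    (hx : x ∈ Available s t) (h : ∀ y ∈ Available s t, prefRank s.pref x ≤ prefRank s.pref y) :
    choice s t = x :=
  prefRank_inj (choice_mem_available s t) hx
    (le_antisymm (prefRank_choice_le hx) (h _ (choice_mem_available s t)))

/-- Raising thresholds does not affect a student whose choice stays available. -/
lemma choice_eq_of_le {m J : ℕ} {s : Student m J} {t t' : Fin m → ℕ} (h : t ≤ t')
    (hx : choice s t ∈ Available s t') : choice s t' = choice s t :=
  choice_eq_of_forall_le hx fun _ hy => prefRank_choice_le (Available.anti h hy)

lemma choice_eq_some_of_le {m J : ℕ} {s : Student m J} {t t' : Fin m → ℕ} (h : t ≤ t')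
    {u : Fin m} (hu : choice s t = some u) (hs : t' u ≤ (s.score u : ℕ)) :
    choice s t' = some u := by
  rw [choice_eq_of_le h, hu]
  intro v hv
  refine ⟨(choice_mem_available s t v hv).1, ?_⟩
  rw [hu] at hv
  obtain rfl := Option.some.inj hv
  exact hs

lemma score_le_of_choice {m J : ℕ} {s : Student m J} {t : Fin m → ℕ} {u : Fin m}
    (h : choice s t = some u) : t u ≤ (s.score u : ℕ) :=
  (choice_mem_available s t u h).2

lemma choice_eq_or_prefers {m J : ℕ} {s : Student m J} {t : Fin m → ℕ} {u : Fin m}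
    (h : u ∈ s.pref.1 → t u ≤ (s.score u : ℕ)) :
    choice s t = some u ∨ Prefers s.pref (choice s t) (some u) := by
  by_cases hu : u ∈ s.pref.1
  · have hav : some u ∈ Available s t := by
      intro v hv
      obtain rfl := Option.some.inj hv
      exact ⟨hu, h hu⟩
    rcases (prefRank_choice_le hav).lt_or_eq with h1 | h1
    · exact Or.inr h1
    · exact Or.inl (prefRank_inj (choice_mem_available s t) hav h1)
  · right
    have := prefRank_le_length (choice_mem_available s t)
    unfold Prefers
    have h2 : prefRank s.pref (some u) = s.pref.1.length + 1 := by simp [prefRank, hu]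
    omega

lemma mem_enrolled {n m : ℕ} {μ : Matching n m} {u : Fin m} {a : Fin n} :
    a ∈ enrolled μ u ↔ μ a = some u := by
  simp [enrolled]

/-! ### Lowering a threshold -/

/-- The thresholds `t` with the threshold of `u` lowered by one. -/
def lower {m : ℕ} (t : Fin m → ℕ) (u : Fin m) : Fin m → ℕ := Function.update t u (t u - 1)

lemma lower_le {m : ℕ} (t : Fin m → ℕ) (u : Fin m) : lower t u ≤ t := by
  intro v
  by_cases h : v = u
  · subst h; simp [lower]
  · simp [lower, h]

/-- A newcomer at the lowered school has score exactly one below the old threshold, and scores are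
distinct. The other schools can only lose students. -/
lemma card_enrolled_lower_le {n m J : ℕ} {D : Database n m J} (hD : UniqueScores D)
    (t : Fin m → ℕ) (u v : Fin m) :
    (enrolled (inducedMatching D (lower t u)) v).card ≤
      (enrolled (inducedMatching D t) v).card + if v = u then 1 else 0 := by
  classical
  by_cases h : v = u
  · subst h
    rw [if_pos rfl]
    have hsub : enrolled (inducedMatching D (lower t v)) v ⊆
        enrolled (inducedMatching D t) v ∪
          Finset.univ.filter fun a => ((D a).score v : ℕ) = t v - 1 := by
      intro a ha
      rw [mem_enrolled] at ha
      have hs := score_le_of_choice ha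
      by_cases h1 : t v ≤ ((D a).score v : ℕ)
      · refine Finset.mem_union_left _ (mem_enrolled.2 ?_)
        exact choice_eq_some_of_le (lower_le t v) ha h1
      · refine Finset.mem_union_right _ ?_
        simp only [lower, Function.update_self] at hs
        simp only [Finset.mem_filter, Finset.mem_univ, true_and]
        omega
    refine (Finset.card_le_card hsub).trans ((Finset.card_union_le _ _).trans ?_)
    gcongr
    refine Finset.card_le_one.2 fun a ha b hb => hD v ?_
    simp only [Finset.mem_filter, Finset.mem_univ, true_and] at ha hb
    exact Fin.ext (ha.trans hb.symm)
  · rw [if_neg h, add_zero]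
    refine Finset.card_le_card fun a ha => ?_
    rw [mem_enrolled] at ha ⊢
    have hs := score_le_of_choice ha
    simp only [lower, Function.update_of_ne h] at hs
    exact choice_eq_some_of_le (lower_le t u) ha hs

lemma card_enrolled_top_le_one {n m J : ℕ} {D : Database n m J} (hD : UniqueScores D)
    (u : Fin m) : (enrolled (inducedMatching D fun _ => J) u).card ≤ 1 := by
  refine Finset.card_le_one.2 fun a ha b hb => hD u ?_
  rw [mem_enrolled] at ha hb
  have h1 := score_le_of_choice ha
  have h2 := score_le_of_choice hb
  have h3 := ((D a).score u).is_lt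
  have h4 := ((D b).score u).is_lt
  exact Fin.ext (by simp only at h1 h2 ⊢; omega)

/-! ### Market-clearing thresholds -/

/-- Thresholds that are positive only at schools that they fill. -/
structure Clearing {n m J : ℕ} (C : Fin m → ℕ) (D : Database n m J) (t : Fin m → ℕ) : Prop where
  le_top : ∀ u, t u ≤ J
  full : ∀ u, 0 < t u → C u ≤ (enrolled (inducedMatching D t) u).card

/-- Lowering the threshold of an under-enrolled school does not cross clearing thresholds. -/
lemma Clearing.le_lower {n m J : ℕ} {C : Fin m → ℕ} {D : Database n m J} {r t : Fin m → ℕ}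
    (hr : Clearing C D r) (h : r ≤ t) {u : Fin m}
    (hu : (enrolled (inducedMatching D t) u).card < C u) : r ≤ lower t u := by
  intro v
  by_cases hv : v = u
  · subst hv
    simp only [lower, Function.update_self]
    by_contra hlt
    have h0 : r v ≤ t v := h v
    have heq : r v = t v := by omega
    have hpos : 0 < r v := by omega
    -- Passing from r to t raises the thresholds elsewhere but not at v, so v keeps all its
    -- students; being full under r, it would be full under t.
    have hsub : enrolled (inducedMatching D r) v ⊆ enrolled (inducedMatching D t) v := by
      intro a ha
      rw [mem_enrolled] at ha ⊢
      exact choice_eq_some_of_le h ha (heq ▸ score_le_of_choice ha)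
    have := Finset.card_le_card hsub
    have := hr.full v hpos
    omega
  · simpa [lower, hv] using h v

/-- Thresholds that fill all schools up to a fraction `α` induce an approximately stable
matching. -/
lemma isApproxStable_inducedMatching {n m J : ℕ} {α : ℝ} {C : Fin m → ℕ} {D : Database n m J}
    {t : Fin m → ℕ} (hC : ∀ u, (enrolled (inducedMatching D t) u).card ≤ C u)
    (hfull : ∀ u, 0 < t u → (1 - α) * (C u : ℝ) ≤ (enrolled (inducedMatching D t) u).card) :
    IsApproxStable α C D (inducedMatching D t) where
  individuallyRational a u h := (choice_mem_available (D a) t u h).1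
  feasible := hC
  noBlockingFilled a u h := by
    by_cases hs : u ∈ (D a).pref.1 → t u ≤ ((D a).score u : ℕ)
    · exact Or.inl ((choice_eq_or_prefers hs).resolve_left h)
    · right
      intro a' ha'
      have := score_le_of_choice (mem_enrolled.1 ha')
      push Not at hs
      exact Fin.lt_def.2 (by omega)
  noBlockingEmpty u h a := by
    refine choice_eq_or_prefers fun _ => ?_
    have : t u = 0 := by
      by_contra h0
      exact absurd (hfull u (Nat.pos_of_ne_zero h0)) (not_le.2 h)
    omega

/-- Every exactly stable matching is induced by clearing thresholds. -/
lemma exists_clearing_of_stable {n m J : ℕ} {C : Fin m → ℕ} (hC : ∀ u, 0 < C u)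
    {D : Database n m J} {ν : Matching n m} (hν : IsApproxStable 0 C D ν) :
    ∃ t, Clearing C D t ∧ inducedMatching D t = ν := by
  classical
  have hne : ∀ u, C u ≤ (enrolled ν u).card → (enrolled ν u).Nonempty := fun u h =>
    Finset.card_pos.1 ((hC u).trans_le h)
  -- The cutoff is the lowest enrolled score at a full school and 0 elsewhere. A preferred school
  -- within reach would then be a blocking pair, with a filled seat in the first case and an empty
  -- one in the second.
  let t : Fin m → ℕ := fun u =>
    if h : C u ≤ (enrolled ν u).card then
      (enrolled ν u).inf' (hne u h) fun a => ((D a).score u : ℕ)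
    else 0
  have hle : ∀ a u, ν a = some u → t u ≤ ((D a).score u : ℕ) := by
    intro a u h
    by_cases hf : C u ≤ (enrolled ν u).card
    · simp only [t, hf, dif_pos]
      exact Finset.inf'_le (fun a => ((D a).score u : ℕ)) (mem_enrolled.2 h)
    · simp [t, hf]
  have hind : inducedMatching D t = ν := by
    funext a
    refine choice_eq_of_forall_le (fun u hu => ⟨hν.individuallyRational a u hu, hle a u hu⟩) ?_
    intro y hy
    cases y with
    | none =>
      change _ ≤ (D a).pref.1.length
      exact prefRank_le_length (t := t)
        (fun u hu => ⟨hν.individuallyRational a u hu, hle a u hu⟩)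
    | some w =>
      by_cases hw : ν a = some w
      · rw [hw]
      by_cases hf : C w ≤ (enrolled ν w).card
      · rcases hν.noBlockingFilled a w hw with h | h
        · exact h.le
        · exfalso
          have h1 := (hy w rfl).2
          simp only [t, hf, dif_pos] at h1
          obtain ⟨b, hb, hb'⟩ := Finset.exists_mem_eq_inf' (hne w hf)
            fun a => ((D a).score w : ℕ)
          rw [hb'] at h1
          have := Fin.lt_def.1 (h b hb)
          omega
      · have hf' : ((enrolled ν w).card : ℝ) < (1 - 0) * (C w : ℝ) := by
          rw [sub_zero, one_mul]
          exact_mod_cast not_le.1 hf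
        rcases hν.noBlockingEmpty w hf' a with h | h
        · exact absurd h hw
        · exact h.le
  refine ⟨t, ⟨fun u => ?_, fun u hu => ?_⟩, hind⟩
  · by_cases hf : C u ≤ (enrolled ν u).card
    · obtain ⟨b, hb⟩ := hne u hf
      exact (hle b u (mem_enrolled.1 hb)).trans (Nat.lt_succ_iff.1 ((D b).score u).is_lt)
    · simp [t, hf]
  · rw [hind]
    by_contra hf
    simp [t, hf] at hu

/-- The largest clearing thresholds. -/
lemma exists_greatest_clearing {n m J : ℕ} {C : Fin m → ℕ} (hC : ∀ u, 0 < C u)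
    {D : Database n m J} (hD : UniqueScores D) :
    ∃ t, Clearing C D t ∧ (∀ u, (enrolled (inducedMatching D t) u).card ≤ C u) ∧
      ∀ r, Clearing C D r → r ≤ t := by
  classical
  -- Exact deferred acceptance as an extremal argument: among feasible thresholds above all clearing
  -- ones, take a minimal total. If some positive threshold belonged to a school with a free seat,
  -- lowering it would preserve `P`.
  let P : (Fin m → ℕ) → Prop := fun t => (∀ u, t u ≤ J) ∧
    (∀ u, (enrolled (inducedMatching D t) u).card ≤ C u) ∧ ∀ r, Clearing C D r → r ≤ t
  have hP : ∃ N t, P t ∧ ∑ u, t u = N :=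
    ⟨_, fun _ => J, ⟨fun _ => le_rfl, fun u => (card_enrolled_top_le_one hD u).trans (hC u),
      fun r hr u => hr.le_top u⟩, rfl⟩
  obtain ⟨t, ht, hsum⟩ := Nat.find_spec hP
  refine ⟨t, ⟨ht.1, fun u hu => ?_⟩, ht.2.1, ht.2.2⟩
  by_contra hlt
  have hlow : P (lower t u) := by
    refine ⟨fun v => (lower_le t u v).trans (ht.1 v), fun v => ?_, fun r hr =>
      hr.le_lower (ht.2.2 r hr) (not_le.1 hlt)⟩
    refine (card_enrolled_lower_le hD t u v).trans ?_
    split_ifs with h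
    · subst h; omega
    · exact ht.2.1 v
  refine Nat.find_min hP (m := ∑ v, lower t u v) ?_ ⟨lower t u, hlow, rfl⟩
  rw [← hsum]
  refine Finset.sum_lt_sum (fun v _ => lower_le t u v) ⟨u, Finset.mem_univ u, ?_⟩
  simp only [lower, Function.update_self]
  omega

/-- Thresholds above the largest clearing ones induce a school-dominant matching. -/
lemma schoolDominant_of_le {n m J : ℕ} {C : Fin m → ℕ} (hC : ∀ u, 0 < C u)
    {D : Database n m J} (hD : UniqueScores D) {t : Fin m → ℕ}
    (ht : ∀ r, Clearing C D r → r ≤ t) : SchoolDominant C D (inducedMatching D t) := by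
  classical
  obtain ⟨r, hr, hrC, hmax⟩ := exists_greatest_clearing hC hD
  refine ⟨inducedMatching D r, ⟨isApproxStable_inducedMatching hrC fun u hu => ?_, ?_⟩, ?_⟩
  · rw [sub_zero, one_mul]
    exact_mod_cast hr.full u hu
  · intro ν hν u s
    obtain ⟨q, hq, rfl⟩ := exists_clearing_of_stable hC hν
    -- Above the cutoff r u, raising q to r loses no student of u with score at least s. Below it,
    -- all students enrolled under r count, and r u > 0 means that u is full.
    by_cases hs : r u ≤ s
    · refine Finset.card_le_card fun a ha => ?_
      rw [Finset.mem_filter, mem_enrolled] at ha ⊢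
      exact ⟨choice_eq_some_of_le (hmax q hq) ha.1 (hs.trans ha.2), ha.2⟩
    · rw [Finset.filter_true_of_mem (s := enrolled (inducedMatching D r) u)]
      · refine (Finset.card_filter_le _ _).trans ((hν.feasible u).trans (hr.full u (by omega)))
      · intro a ha
        have := score_le_of_choice (mem_enrolled.1 ha)
        omega
  · intro u a ha a' ha'
    rw [Finset.mem_sdiff, mem_enrolled, mem_enrolled] at ha ha'
    have h1 := score_le_of_choice ha.1
    -- Raising r to t removes a student from u only if she misses the new cutoff there, while the
    -- student a has passed it.
    have h2 : ¬ t u ≤ ((D a').score u : ℕ) := fun h =>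
      ha'.2 (choice_eq_some_of_le (ht r hr) ha'.1 h)
    exact Fin.lt_def.2 (by omega)

/-! ### Binary expansions and counters -/

/-- The number `t` with its `i` lowest binary digits cleared. -/
def clearBits (t i : ℕ) : ℕ := t / 2 ^ i * 2 ^ i

/-- The total noise that a counter releases at time `t`. -/
def releasedNoise (y : ℕ → ℝ) (t : ℕ) : ℝ :=
  ∑ i ∈ (Finset.range t.size).filter (fun i => t.testBit i = true), y (clearBits t i - 1)

lemma testBit_iff (t i : ℕ) : t.testBit i = true ↔ t / 2 ^ i % 2 = 1 := by
  simp [Nat.testBit_eq_decide_div_mod_eq]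

lemma succ_div_two_pow_of_lt {t j : ℕ} (h : padicValNat 2 (t + 1) < j) :
    (t + 1) / 2 ^ j = t / 2 ^ j := by
  rw [Nat.succ_div, if_neg, add_zero]
  rw [padicValNat_dvd_iff_le (by omega)]
  omega

lemma exists_eq_two_pow_mul_odd (t : ℕ) :
    ∃ q, t + 1 = 2 ^ padicValNat 2 (t + 1) * (2 * q + 1) := by
  obtain ⟨c, hc⟩ := pow_padicValNat_dvd (p := 2) (n := t + 1)
  have hodd : ¬ 2 ∣ c := by
    rintro ⟨d, rfl⟩
    refine pow_succ_padicValNat_not_dvd (p := 2) (n := t + 1) (by omega) ⟨d, ?_⟩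
    rw [pow_succ, mul_assoc]
    exact hc
  exact ⟨c / 2, by rw [hc.trans (congrArg _ (by omega : c = 2 * (c / 2) + 1))]; simp⟩

lemma testBit_succ_of_lt {t j : ℕ} (h : j < padicValNat 2 (t + 1)) :
    (t + 1).testBit j = false := by
  rw [Bool.eq_false_iff, ne_eq, testBit_iff]
  obtain ⟨q, hq⟩ := exists_eq_two_pow_mul_odd t
  obtain ⟨d, hd⟩ := Nat.exists_eq_add_of_lt h
  have h2 : (t + 1) / 2 ^ j = 2 * (2 ^ d * (2 * q + 1)) := by
    apply Nat.div_eq_of_eq_mul_right (by positivity)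
    rw [hd] at hq
    rw [hq]
    ring
  omega

lemma succ_div_two_pow_val (t : ℕ) : (t + 1) / 2 ^ padicValNat 2 (t + 1) % 2 = 1 := by
  obtain ⟨q, hq⟩ := exists_eq_two_pow_mul_odd t
  have h2 : (t + 1) / 2 ^ padicValNat 2 (t + 1) = 2 * q + 1 :=
    Nat.div_eq_of_eq_mul_right (by positivity) hq
  omega

lemma testBit_succ_self (t : ℕ) : (t + 1).testBit (padicValNat 2 (t + 1)) = true :=
  (testBit_iff _ _).2 (succ_div_two_pow_val t)

lemma testBit_val (t : ℕ) : t.testBit (padicValNat 2 (t + 1)) = false := by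
  rw [Bool.eq_false_iff, ne_eq, testBit_iff]
  have h := succ_div_two_pow_val t
  rw [Nat.succ_div, if_pos pow_padicValNat_dvd] at h
  omega

lemma testBit_succ_of_gt {t j : ℕ} (h : padicValNat 2 (t + 1) < j) :
    (t + 1).testBit j = t.testBit j := by
  simp [Nat.testBit_eq_decide_div_mod_eq, succ_div_two_pow_of_lt h]

lemma clearBits_succ_of_gt {t j : ℕ} (h : padicValNat 2 (t + 1) < j) :
    clearBits (t + 1) j = clearBits t j := by
  simp [clearBits, succ_div_two_pow_of_lt h]

lemma clearBits_succ_self (t : ℕ) : clearBits (t + 1) (padicValNat 2 (t + 1)) = t + 1 :=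
  Nat.div_mul_cancel pow_padicValNat_dvd

/-- The counter `c` has read `t` symbols of sum `S`, with the noise `y`. -/
structure Counter.Inv (c : Counter) (y : ℕ → ℝ) (t : ℕ) (S : ℤ) : Prop where
  time : c.time = t
  partialSum_eq_zero : ∀ i, t.testBit i = false → c.partialSum i = 0
  -- The block stored at digit i was closed when the time became `clearBits t i`; its noise carries
  -- the index of the time before that symbol was read.
  noisySum : ∀ i, t.testBit i = true → c.noisySum i = c.partialSum i + y (clearBits t i - 1)
  sum : ∀ K, t.size ≤ K → ∑ j ∈ Finset.range K, c.partialSum j = S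

lemma Counter.inv_init (y : ℕ → ℝ) : Counter.init.Inv y 0 0 :=
  ⟨rfl, fun _ _ => rfl, fun i h => by simp at h, fun K _ => by simp [Counter.init]⟩

/-- This is binary carrying: digits below i become 0, digit i turns from 0 to 1, higher digits stay.
The partial sum at i was zero before, so merging the lower blocks with σ raises the total by exactly
σ. -/
lemma Counter.Inv.read {c : Counter} {y : ℕ → ℝ} {t : ℕ} {S : ℤ} (h : c.Inv y t S) (σ : ℤ) :
    (c.read σ (y c.time)).Inv y (t + 1) (S + σ) := by
  obtain ⟨rfl, h1, h2, h3⟩ := h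
  set i := padicValNat 2 (c.time + 1) with hi
  refine ⟨rfl, fun j hj => ?_, fun j hj => ?_, fun K hK => ?_⟩
  · rcases lt_trichotomy j i with hji | hji | hji
    · simp [Counter.read, ← hi, hji]
    · rw [hji, hi, testBit_succ_self] at hj
      exact absurd hj (by simp)
    · rw [testBit_succ_of_gt hji] at hj
      simpa [Counter.read, ← hi, hji.not_gt, hji.ne'] using h1 j hj
  · rcases lt_trichotomy j i with hji | hji | hji
    · rw [testBit_succ_of_lt hji] at hj
      exact absurd hj (by simp)
    · subst hji
      simp [Counter.read, ← hi, hi ▸ clearBits_succ_self c.time]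
    · rw [testBit_succ_of_gt hji] at hj
      simpa [Counter.read, ← hi, hji.not_gt, hji.ne', clearBits_succ_of_gt hji] using h2 j hj
  · have hiK : i < K := by
      refine lt_of_lt_of_le ?_ hK
      rw [Nat.lt_size]
      exact Nat.ge_two_pow_of_testBit (testBit_succ_self c.time)
    obtain ⟨r, rfl⟩ := Nat.exists_eq_add_of_lt hiK
    have hS := h3 (i + r + 1) ((Nat.size_le_size (Nat.le_succ _)).trans hK)
    rw [show i + r + 1 = i + 1 + r by ring, Finset.sum_range_add, Finset.sum_range_succ] at hS ⊢
    rw [h1 i (testBit_val _)] at hS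
    rw [Finset.sum_eq_zero (s := Finset.range i) (f := (c.read σ (y c.time)).partialSum)]
    · have ht : ∑ x ∈ Finset.range r, (c.read σ (y c.time)).partialSum (i + 1 + x) =
          ∑ x ∈ Finset.range r, c.partialSum (i + 1 + x) := by
        refine Finset.sum_congr rfl fun x _ => ?_
        simp [Counter.read, ← hi, show ¬ (i + 1 + x < i) by omega,
          show ¬ (i + 1 + x = i) by omega]
      rw [ht]
      simp only [Counter.read, ← hi, lt_irrefl, if_false, if_true]
      linarith
    · intro j hj
      simp [Counter.read, ← hi, Finset.mem_range.1 hj]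

lemma Counter.Inv.value_eq {c : Counter} {y : ℕ → ℝ} {t : ℕ} {S : ℤ} (h : c.Inv y t S) :
    c.value = S + releasedNoise y t := by
  obtain ⟨rfl, h1, h2, h3⟩ := h
  unfold Counter.value releasedNoise
  rw [Finset.sum_congr rfl fun i hi => h2 i (Finset.mem_filter.1 hi).2,
    Finset.sum_add_distrib, ← h3 _ le_rfl]
  congr 1
  push_cast
  rw [Finset.sum_filter]
  refine Finset.sum_congr rfl fun i _ => ?_
  split_ifs with hb
  · rfl
  · rw [h1 i (by simpa using hb)]
    simp

/-! ### Private deferred acceptance without counters -/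

/-- The transition of a single student when the thresholds are `t`: from the current match and the
number of accepted proposals to the new ones. -/
def studentStep {m J : ℕ} (k : ℕ) (s : Student m J) (t : Fin m → ℕ) (x : Option (Fin m) × ℕ) :
    Option (Fin m) × ℕ :=
  open Classical in if x.2 < k ∧ x.1 ≠ choice s t then (choice s t, x.2 + 1) else x

/-- The discrete part of the state of the algorithm: the thresholds, the match and the number of
accepted proposals of each student, and the number of passes made. -/
abbrev Core (n m : ℕ) := (Fin m → ℕ) × (Fin n → Option (Fin m) × ℕ) × ℕ

/-- The current number of students at the school `u`. -/
def Core.load {n m : ℕ} (x : Core n m) (u : Fin m) : ℕ := (enrolled (fun a => (x.2.1 a).1) u).card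

/-- The initial state. -/
def Core.init (n m J : ℕ) : Core n m := (fun _ => J, fun _ => (none, 0), 0)

/-- One pass when the under-enrolled schools are `U`. -/
def Core.step {n m J : ℕ} (k : ℕ) (sel : SelectionRule m) (D : Database n m J)
    (U : Finset (Fin m)) (x : Core n m) : Core n m :=
  open Classical in
  if U.Nonempty then
    (lower x.1 (sel.pick x.1 U),
      fun a => studentStep k (D a) (lower x.1 (sel.pick x.1 U)) (x.2.1 a), x.2.2 + 1)
  else x

/-- The schools that appear under-enrolled when the counters have the noise `y`. -/
def Core.under {n m : ℕ} (C : Fin m → ℕ) (E : ℝ) (y : ℕ → Fin m → ℝ) (x : Core n m) :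
    Finset (Fin m) :=
  open Classical in Finset.univ.filter fun u =>
    (x.load u : ℝ) + releasedNoise (fun i => y i u) (x.2.2 * n) < (C u : ℝ) - E ∧ 0 < x.1 u

/-- The state after `r` iterations. -/
def Core.run {n m J : ℕ} (k : ℕ) (sel : SelectionRule m) (C : Fin m → ℕ) (E : ℝ)
    (D : Database n m J) (y : ℕ → Fin m → ℝ) (r : ℕ) : Core n m :=
  (fun x => Core.step k sel D (x.under C E y) x)^[r] (Core.init n m J)

lemma Core.run_succ {n m J : ℕ} (k : ℕ) (sel : SelectionRule m) (C : Fin m → ℕ) (E : ℝ)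
    (D : Database n m J) (y : ℕ → Fin m → ℝ) (r : ℕ) :
    Core.run k sel C E D y (r + 1) =
      Core.step k sel D ((Core.run k sel C E D y r).under C E y)
        (Core.run k sel C E D y r) := by
  simp only [Core.run, Function.iterate_succ_apply']

lemma card_enrolled_eq_sum {n m : ℕ} (μ : Matching n m) (u : Fin m) :
    ((enrolled μ u).card : ℤ) = ∑ a, if μ a = some u then 1 else 0 := by
  simp [enrolled]

open Classical in
lemma card_enrolled_update {n m : ℕ} (μ : Matching n m) (a : Fin n) (w : Option (Fin m))
    (hw : μ a ≠ w) (u : Fin m) :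
    ((enrolled (Function.update μ a w) u).card : ℤ) = (enrolled μ u).card +
      (if w = some u then 1 else if μ a = some u then -1 else 0) := by
  rw [card_enrolled_eq_sum, card_enrolled_eq_sum,
    ← Finset.add_sum_erase _ _ (Finset.mem_univ a),
    ← Finset.add_sum_erase (a := a) Finset.univ (fun b => if μ b = some u then (1 : ℤ) else 0)
      (Finset.mem_univ a)]
  rw [Finset.sum_congr rfl (g := fun b => if μ b = some u then (1 : ℤ) else 0)
    (s₁ := Finset.univ.erase a) fun b hb => by
      rw [Function.update_of_ne (Finset.ne_of_mem_erase hb)]]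
  rw [Function.update_self]
  by_cases h1 : w = some u
  · have h2 : μ a ≠ some u := fun h => hw (h.trans h1.symm)
    simp only [h1, h2, if_true, if_false]
    ring
  · by_cases h2 : μ a = some u
    · simp only [h1, h2, if_true, if_false]
      ring
    · simp only [h1, h2, if_false]
      ring

/-- The counters agree with the matching after `t` symbols. -/
def DAState.Counts {n m : ℕ} (s : DAState n m) (y : ℕ → Fin m → ℝ) (t : ℕ) : Prop :=
  ∀ j, (s.counter j).Inv (fun i => y i j) t (enrolled s.matching j).card

section ProcessStudent

variable {n m J : ℕ} (k : ℕ) (D : Database n m J) (y : ℕ → Fin m → ℝ) (s : DAState n m)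

lemma DAState.processStudent_threshold (a : Fin n) :
    (s.processStudent k D y a).threshold = s.threshold := rfl

lemma DAState.processStudent_self (a : Fin n) :
    ((s.processStudent k D y a).matching a, (s.processStudent k D y a).accepted a) =
      studentStep k (D a) s.threshold (s.matching a, s.accepted a) := by
  simp only [DAState.processStudent, studentStep]
  split_ifs <;> simp

lemma DAState.processStudent_of_ne {a b : Fin n} (h : b ≠ a) :
    ((s.processStudent k D y a).matching b, (s.processStudent k D y a).accepted b) =
      (s.matching b, s.accepted b) := by
  simp only [DAState.processStudent]
  split_ifs <;> simp [h]

variable {s y}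

lemma DAState.Counts.processStudent {t : ℕ} (h : s.Counts y t) (a : Fin n) :
    (s.processStudent k D y a).Counts y (t + 1) := by
  classical
  intro j
  simp only [DAState.processStudent]
  by_cases hm : s.accepted a < k ∧ s.matching a ≠ choice (D a) s.threshold
  · simp only [if_pos hm]
    rw [card_enrolled_update _ _ _ hm.2]
    exact (h j).read _
  · simp only [if_neg hm]
    simpa using (h j).read 0

variable (s y)

/-- Since thresholds stay fixed during a pass, no student's transition sees another's, and the
sequential pass is a simultaneous update. -/
lemma DAState.foldl_processStudent (l : List (Fin n)) (hl : l.Nodup) (t : ℕ)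
    (h : s.Counts y t) :
    (l.foldl (DAState.processStudent k D y) s).threshold = s.threshold ∧
    (∀ a, ((l.foldl (DAState.processStudent k D y) s).matching a,
        (l.foldl (DAState.processStudent k D y) s).accepted a) =
      if a ∈ l then studentStep k (D a) s.threshold (s.matching a, s.accepted a)
      else (s.matching a, s.accepted a)) ∧
    (l.foldl (DAState.processStudent k D y) s).Counts y (t + l.length) := by
  induction l generalizing s t with
  | nil => exact ⟨rfl, fun a => by simp, h⟩
  | cons b l ih =>
    obtain ⟨hb, hl⟩ := List.nodup_cons.1 hl
    obtain ⟨h1, h2, h3⟩ := ih (s.processStudent k D y b) hl (t + 1) (h.processStudent k D b)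
    refine ⟨h1, fun a => ?_, ?_⟩
    · rw [List.foldl_cons, h2 a]
      by_cases hab : a = b
      · subst hab
        rw [if_neg hb, if_pos List.mem_cons_self]
        exact DAState.processStudent_self k D y s a
      · rw [DAState.processStudent_of_ne k D y s hab, DAState.processStudent_threshold]
        simp [hab]
    · rw [List.foldl_cons, List.length_cons]
      convert h3 using 1
      ring

end ProcessStudent

/-- The state `s` of the algorithm has the discrete part `x`. -/
structure DAState.Rel {n m : ℕ} (y : ℕ → Fin m → ℝ) (s : DAState n m) (x : Core n m) : Prop where
  threshold : s.threshold = x.1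
  student : ∀ a, (s.matching a, s.accepted a) = x.2.1 a
  counts : s.Counts y (x.2.2 * n)

lemma DAState.rel_init (n m J : ℕ) (y : ℕ → Fin m → ℝ) :
    (DAState.init n m J).Rel y (Core.init n m J) := by
  refine ⟨rfl, fun _ => rfl, fun j => ?_⟩
  simp only [Core.init, zero_mul]
  have h0 : (enrolled (DAState.init n m J).matching j).card = 0 := by
    simp [DAState.init, enrolled]
  rw [h0]
  exact Counter.inv_init fun i => y i j

lemma DAState.Rel.load {n m : ℕ} {y : ℕ → Fin m → ℝ} {s : DAState n m} {x : Core n m}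
    (h : s.Rel y x) (u : Fin m) : (enrolled s.matching u).card = x.load u := by
  have : s.matching = fun a => (x.2.1 a).1 := funext fun a => by rw [← h.student a]
  rw [this]
  rfl

lemma DAState.Rel.underEnrolled {n m : ℕ} {y : ℕ → Fin m → ℝ} {s : DAState n m} {x : Core n m}
    (h : s.Rel y x) (C : Fin m → ℕ) (E : ℝ) : s.underEnrolled C E = x.under C E y := by
  unfold DAState.underEnrolled Core.under
  refine Finset.filter_congr fun u _ => ?_
  rw [(h.counts u).value_eq, h.load, h.threshold]
  simp

lemma DAState.Rel.step {n m J : ℕ} {y : ℕ → Fin m → ℝ} {s : DAState n m} {x : Core n m}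
    (h : s.Rel y x) (k : ℕ) (sel : SelectionRule m) (C : Fin m → ℕ) (E : ℝ)
    (D : Database n m J) :
    (DAState.step k sel C E D y s).Rel y (Core.step k sel D (x.under C E y) x) := by
  classical
  unfold DAState.step Core.step
  rw [h.underEnrolled C E]
  by_cases hU : (x.under C E y).Nonempty
  · simp only [if_pos hU]
    obtain ⟨h1, h2, h3⟩ := DAState.foldl_processStudent k D y
      { s with threshold := Function.update s.threshold (sel.pick s.threshold (x.under C E y))
                (s.threshold (sel.pick s.threshold (x.under C E y)) - 1) }
      (List.finRange n) (List.nodup_finRange n) (x.2.2 * n) h.counts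
    refine ⟨?_, fun a => ?_, ?_⟩
    · rw [h1, h.threshold]
      rfl
    · rw [h2 a, if_pos (List.mem_finRange a), h.student a, h.threshold]
      rfl
    · convert h3 using 1
      rw [List.length_finRange]
      ring
  · simp only [if_neg hU]
    exact h

lemma runDA_eq_run {n m J : ℕ} (k : ℕ) (sel : SelectionRule m) (C : Fin m → ℕ) (E : ℝ)
    (D : Database n m J) (y : ℕ → Fin m → ℝ) :
    runDA k sel C E D y = (Core.run k sel C E D y (m * J)).1 := by
  have h : ∀ r, ((DAState.step k sel C E D y)^[r] (DAState.init n m J)).Rel y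
      (Core.run k sel C E D y r) := by
    intro r
    induction r with
    | zero => exact DAState.rel_init n m J y
    | succ r ih =>
      rw [Function.iterate_succ_apply', Core.run_succ]
      exact ih.step k sel C E D
  exact (h _).threshold

/-! ### The Laplace distribution -/

lemma lintegral_laplace {b : ℝ} (hb : 0 < b) {f : ℝ → ENNReal} (hf : Measurable f) :
    ∫⁻ x, f x ∂(laplace b) =
      ∫⁻ x, ENNReal.ofReal (1 / (2 * b) * Real.exp (-(|x| / b))) * f x := by
  rw [laplace, if_pos hb, lintegral_withDensity_eq_lintegral_mul _ (by fun_prop) hf]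
  rfl

/-- Used at s = 0 for total mass one and at s² = 1/2 for the tail bound. -/
lemma lintegral_exp_laplace {b s : ℝ} (hb : 0 < b) (hs : |s| < 1) :
    ∫⁻ x, ENNReal.ofReal (Real.exp (s / b * x)) ∂(laplace b) = ENNReal.ofReal (1 / (1 - s ^ 2)) := by
  obtain ⟨hs1, hs2⟩ := abs_lt.1 hs
  rw [lintegral_laplace hb (by fun_prop), ← lintegral_add_compl _ measurableSet_Iic (A := Set.Iic 0),
    Set.compl_Iic]
  have h1 : ∫⁻ x in Set.Iic (0 : ℝ), ENNReal.ofReal (1 / (2 * b) * Real.exp (-(|x| / b))) *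
      ENNReal.ofReal (Real.exp (s / b * x)) = ENNReal.ofReal (1 / (2 * (1 + s))) := by
    have ha : 0 < (1 + s) / b := div_pos (by linarith) hb
    have hi := (integrableOn_exp_mul_Iic ha 0).const_mul (1 / (2 * b))
    have := ofReal_integral_eq_lintegral_ofReal hi (Filter.Eventually.of_forall fun x => by
      positivity)
    rw [integral_const_mul, integral_exp_mul_Iic ha] at this
    rw [setLIntegral_congr_fun measurableSet_Iic (g := fun x =>
      ENNReal.ofReal (1 / (2 * b) * Real.exp ((1 + s) / b * x))), ← this]
    · congr 1
      have : 1 + s ≠ 0 := by linarith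
      simp only [mul_zero, Real.exp_zero]
      field_simp
    · intro x hx
      beta_reduce
      rw [← ENNReal.ofReal_mul (by positivity), mul_assoc, ← Real.exp_add, abs_of_nonpos hx]
      congr 3
      field_simp
  have h2 : ∫⁻ x in Set.Ioi (0 : ℝ), ENNReal.ofReal (1 / (2 * b) * Real.exp (-(|x| / b))) *
      ENNReal.ofReal (Real.exp (s / b * x)) = ENNReal.ofReal (1 / (2 * (1 - s))) := by
    have ha : (s - 1) / b < 0 := div_neg_of_neg_of_pos (by linarith) hb
    have hi := (integrableOn_exp_mul_Ioi ha 0).const_mul (1 / (2 * b))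
    have := ofReal_integral_eq_lintegral_ofReal hi (Filter.Eventually.of_forall fun x => by
      positivity)
    rw [integral_const_mul, integral_exp_mul_Ioi ha] at this
    rw [setLIntegral_congr_fun measurableSet_Ioi (g := fun x =>
      ENNReal.ofReal (1 / (2 * b) * Real.exp ((s - 1) / b * x))), ← this]
    · congr 1
      have h1 : s - 1 ≠ 0 := by linarith
      have h2 : 1 - s ≠ 0 := by linarith
      simp
      field_simp
      ring
    · intro x hx
      beta_reduce
      rw [← ENNReal.ofReal_mul (by positivity), mul_assoc, ← Real.exp_add,
        abs_of_pos hx]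
      congr 3
      field_simp
      ring
  rw [h1, h2, ← ENNReal.ofReal_add]
  · congr 1
    have h1 : 1 + s ≠ 0 := by linarith
    have h2 : 1 - s ≠ 0 := by linarith
    rw [show 1 - s ^ 2 = (1 + s) * (1 - s) by ring]
    field_simp
    ring
  · exact one_div_nonneg.2 (by linarith)
  · exact one_div_nonneg.2 (by linarith)

instance isProbabilityMeasure_laplace (b : ℝ) : IsProbabilityMeasure (laplace b) := by
  by_cases hb : 0 < b
  · constructor
    have := lintegral_exp_laplace hb (s := 0) (by simp)
    simpa using this
  · rw [laplace, if_neg hb]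
    infer_instance

/-! ### Translation of noise -/

/-- Translating the noise `ν` by `Δ` changes expectations by at most the factor `exp (κ Δ)` up to
raising the integrand to the power `q`. -/
def ShiftBound {E : Type*} [MeasurableSpace E] [Add E] (ν : Measure E) (q : ℝ) (κ : E → ℝ) : Prop :=
  ∀ (Δ : E) (g : E → ENNReal), Measurable g →
    ∫⁻ x, g (x + Δ) ∂ν ≤ ENNReal.ofReal (Real.exp (κ Δ)) * (∫⁻ x, g x ^ q ∂ν) ^ (1 / q)

/-- The density ratio of the Laplace distribution and its translate by `Δ`. -/
def laplaceRatio (b Δ y : ℝ) : ℝ := Real.exp ((|y| - |y - Δ|) / b)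

lemma continuous_laplaceRatio (b Δ : ℝ) : Continuous (laplaceRatio b Δ) := by
  unfold laplaceRatio
  fun_prop

lemma lintegral_laplace_add {b : ℝ} (hb : 0 < b) (Δ : ℝ) {g : ℝ → ENNReal} (hg : Measurable g) :
    ∫⁻ x, g (x + Δ) ∂(laplace b) =
      ∫⁻ y, ENNReal.ofReal (laplaceRatio b Δ y) * g y ∂(laplace b) := by
  have hm := (continuous_laplaceRatio b Δ).measurable
  rw [lintegral_laplace hb (by fun_prop), lintegral_laplace hb (by fun_prop),
    ← lintegral_sub_right_eq_self _ Δ]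
  refine lintegral_congr fun y => ?_
  rw [sub_add_cancel, ← mul_assoc, ← ENNReal.ofReal_mul (by positivity), mul_assoc, laplaceRatio,
    ← Real.exp_add]
  congr 4
  ring

lemma laplaceRatio_mem {b : ℝ} (hb : 0 < b) (Δ y : ℝ) :
    Real.exp (-(|Δ| / b)) ≤ laplaceRatio b Δ y ∧ laplaceRatio b Δ y ≤ Real.exp (|Δ| / b) := by
  have h1 := abs_sub_abs_le_abs_sub y (y - Δ)
  have h2 := abs_sub_abs_le_abs_sub (y - Δ) y
  have e1 : y - (y - Δ) = Δ := by ring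
  have e2 : y - Δ - y = -Δ := by ring
  rw [e1] at h1
  rw [e2, abs_neg] at h2
  unfold laplaceRatio
  rw [Real.exp_le_exp, Real.exp_le_exp, ← neg_div]
  exact ⟨by gcongr; linarith, by gcongr⟩

/-- A convex power lies below its chord. As the density ratio has mean one, averaging the chord
reduces its p-th moment to that of a variable taking only the values exp(h) and exp(-h). -/
lemma chord_bound {p h u : ℝ} (hp : 1 ≤ p) (h1 : Real.exp (-h) ≤ u)
    (h2 : u ≤ Real.exp h) :
    (Real.exp h - Real.exp (-h)) * u ^ p ≤
      (u - Real.exp (-h)) * Real.exp (p * h) + (Real.exp h - u) * Real.exp (-(p * h)) := by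
  rcases (h1.trans h2).lt_or_eq with hlt | heq
  · have hd : 0 < Real.exp h - Real.exp (-h) := by linarith
    have ha : 0 ≤ (u - Real.exp (-h)) / (Real.exp h - Real.exp (-h)) :=
      div_nonneg (by linarith) hd.le
    have hb : 0 ≤ (Real.exp h - u) / (Real.exp h - Real.exp (-h)) :=
      div_nonneg (by linarith) hd.le
    have hc := (convexOn_rpow hp).2 (Set.mem_Ici.2 (Real.exp_pos h).le)
      (Set.mem_Ici.2 (Real.exp_pos (-h)).le) ha hb (by field_simp; ring)
    simp only [smul_eq_mul, ← Real.exp_mul] at hc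
    have he : (u - Real.exp (-h)) / (Real.exp h - Real.exp (-h)) * Real.exp h +
        (Real.exp h - u) / (Real.exp h - Real.exp (-h)) * Real.exp (-h) = u := by
      field_simp
      ring
    rw [he] at hc
    calc _ ≤ (Real.exp h - Real.exp (-h)) * _ := mul_le_mul_of_nonneg_left hc hd.le
      _ = _ := by
        rw [show h * p = p * h by ring, show -h * p = -(p * h) by ring]
        field_simp
  · have hu : u = Real.exp h := le_antisymm h2 (heq ▸ h1)
    rw [hu, heq]
    simp

/-- After extracting 1 - exp(-h), the rest is 2 exp(h/2) cosh((p - 1/2)h), and cosh x ≤ exp(x²/2).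
-/
lemma two_point_bound {p h : ℝ} (hp : 1 ≤ p) (hh : 0 ≤ h) :
    (1 - Real.exp (-h)) * Real.exp (p * h) + (Real.exp h - 1) * Real.exp (-(p * h)) ≤
      (Real.exp h - Real.exp (-h)) * Real.exp (p ^ 2 * h ^ 2 / 2) := by
  have hcosh : Real.exp (p * h) + Real.exp (h - p * h) ≤
      (1 + Real.exp h) * Real.exp (p ^ 2 * h ^ 2 / 2) := by
    have e1 : Real.exp (p * h) + Real.exp (h - p * h) =
        2 * Real.exp (h / 2) * Real.cosh ((p - 1 / 2) * h) := by
      rw [Real.cosh_eq, show p * h = h / 2 + (p - 1 / 2) * h by ring, Real.exp_add,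
        show h - (h / 2 + (p - 1 / 2) * h) = h / 2 + -((p - 1 / 2) * h) by ring, Real.exp_add]
      ring
    have e2 : 2 * Real.exp (h / 2) ≤ 1 + Real.exp h := by
      have : Real.exp h = Real.exp (h / 2) ^ 2 := by rw [← Real.exp_nat_mul]; congr 1; ring
      rw [this]
      nlinarith [sq_nonneg (Real.exp (h / 2) - 1)]
    rw [e1]
    refine mul_le_mul e2 ((Real.cosh_le_exp_half_sq _).trans (Real.exp_le_exp.2 ?_))
      (Real.cosh_pos _).le (by positivity)
    rw [mul_pow]
    have : (p - 1 / 2) ^ 2 ≤ p ^ 2 := by nlinarith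
    nlinarith [mul_le_mul_of_nonneg_right this (sq_nonneg h)]
  have h0 : 0 ≤ 1 - Real.exp (-h) := by
    have := Real.exp_le_one_iff.2 (neg_nonpos.2 hh)
    linarith
  have hm : Real.exp h * Real.exp (-h) = 1 := by rw [← Real.exp_add]; simp
  calc (1 - Real.exp (-h)) * Real.exp (p * h) + (Real.exp h - 1) * Real.exp (-(p * h))
      = (1 - Real.exp (-h)) * (Real.exp (p * h) + Real.exp (h - p * h)) := by
        rw [sub_eq_add_neg h, Real.exp_add]
        linear_combination (Real.exp (-(p * h))) * hm
    _ ≤ (1 - Real.exp (-h)) * ((1 + Real.exp h) * Real.exp (p ^ 2 * h ^ 2 / 2)) :=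
        mul_le_mul_of_nonneg_left hcosh h0
    _ = _ := by linear_combination (-Real.exp (p ^ 2 * h ^ 2 / 2)) * hm

lemma lintegral_laplaceRatio_rpow_le {b : ℝ} (hb : 0 < b) (Δ : ℝ) {p : ℝ} (hp : 1 ≤ p) :
    ∫⁻ y, ENNReal.ofReal (laplaceRatio b Δ y) ^ p ∂(laplace b) ≤
      ENNReal.ofReal (Real.exp (p ^ 2 * (|Δ| / b) ^ 2 / 2)) := by
  set h := |Δ| / b with hdef
  have hh : 0 ≤ h := by positivity
  have hpos : ∀ y, 0 < laplaceRatio b Δ y := fun y => Real.exp_pos _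
  have hbd := laplaceRatio_mem hb Δ
  have hcont := continuous_laplaceRatio b Δ
  have hint : Integrable (laplaceRatio b Δ) (laplace b) :=
    Integrable.of_bound hcont.aestronglyMeasurable (Real.exp h)
      (Filter.Eventually.of_forall fun y => by
        rw [Real.norm_of_nonneg (hpos y).le]
        exact (hbd y).2)
  have hintp : Integrable (fun y => laplaceRatio b Δ y ^ p) (laplace b) :=
    Integrable.of_bound (hcont.rpow_const fun y => Or.inr (by linarith)).aestronglyMeasurable
      (Real.exp h ^ p) (Filter.Eventually.of_forall fun y => by
        rw [Real.norm_of_nonneg (Real.rpow_nonneg (hpos y).le _)]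
        exact Real.rpow_le_rpow (hpos y).le (hbd y).2 (by linarith))
  have hone : ∫ y, laplaceRatio b Δ y ∂(laplace b) = 1 := by
    have h1 := lintegral_laplace_add hb Δ (g := fun _ => 1) measurable_const
    have h2 := ofReal_integral_eq_lintegral_ofReal hint
      (Filter.Eventually.of_forall fun y => (hpos y).le)
    simp only [mul_one, lintegral_const, measure_univ] at h1
    rw [← h1] at h2
    rw [← ENNReal.toReal_ofReal (integral_nonneg fun y => (hpos y).le), h2, ENNReal.toReal_one]
  have hle : ∫ y, laplaceRatio b Δ y ^ p ∂(laplace b) ≤ Real.exp (p ^ 2 * h ^ 2 / 2) := by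
    rcases hh.lt_or_eq with hlt | heq
    · have hd : 0 < Real.exp h - Real.exp (-h) := by
        have := Real.exp_lt_exp.2 (show -h < h by linarith)
        linarith
      have h1 : ∫ y, (Real.exp h - Real.exp (-h)) * laplaceRatio b Δ y ^ p ∂(laplace b) ≤
          ∫ y, (laplaceRatio b Δ y * (Real.exp (p * h) - Real.exp (-(p * h))) +
            (Real.exp h * Real.exp (-(p * h)) - Real.exp (-h) * Real.exp (p * h)))
            ∂(laplace b) := by
        refine integral_mono (hintp.const_mul _) ((hint.mul_const _).add (integrable_const _))
          fun y => ?_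
        have := chord_bound hp (hbd y).1 (hbd y).2
        simp only
        linarith
      rw [integral_const_mul, integral_add (hint.mul_const _) (integrable_const _),
        integral_mul_const, hone, integral_const] at h1
      simp only [probReal_univ, smul_eq_mul, one_mul] at h1
      have h2 := two_point_bound hp hh
      exact le_of_mul_le_mul_left (by linarith) hd
    · have h1 : ∀ y, laplaceRatio b Δ y = 1 := fun y => by
        have := hbd y
        rw [← hdef, ← heq] at this
        simp at this
        linarith
      simp [h1, ← heq]
  calc ∫⁻ y, ENNReal.ofReal (laplaceRatio b Δ y) ^ p ∂(laplace b)
      = ∫⁻ y, ENNReal.ofReal (laplaceRatio b Δ y ^ p) ∂(laplace b) := by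
        refine lintegral_congr fun y => ?_
        rw [ENNReal.ofReal_rpow_of_pos (hpos y)]
    _ = ENNReal.ofReal (∫ y, laplaceRatio b Δ y ^ p ∂(laplace b)) :=
        (ofReal_integral_eq_lintegral_ofReal hintp
          (Filter.Eventually.of_forall fun y => Real.rpow_nonneg (hpos y).le _)).symm
    _ ≤ _ := ENNReal.ofReal_le_ofReal hle

/-- Hölder separates the density ratio from the integrand. The p-th root of its moment bound turns
p² into p, leaving a cost quadratic in Δ. -/
lemma shiftBound_laplace {b : ℝ} (hb : 0 < b) {p q : ℝ} (hpq : p.HolderConjugate q) :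
    ShiftBound (laplace b) q fun Δ => p / (2 * b ^ 2) * Δ ^ 2 := by
  intro Δ g hg
  rw [lintegral_laplace_add hb Δ hg]
  have hm := (continuous_laplaceRatio b Δ).measurable
  refine (ENNReal.lintegral_mul_le_Lp_mul_Lq (laplace b) hpq
    (f := fun y => ENNReal.ofReal (laplaceRatio b Δ y)) (by fun_prop) hg.aemeasurable).trans ?_
  gcongr
  refine (ENNReal.rpow_le_rpow (lintegral_laplaceRatio_rpow_le hb Δ hpq.lt.le)
    (one_div_nonneg.2 hpq.pos.le)).trans_eq ?_
  rw [ENNReal.ofReal_rpow_of_pos (Real.exp_pos _), ← Real.exp_mul]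
  congr 2
  have := hpq.pos.ne'
  rw [div_pow, sq_abs]
  field_simp

/-- This half of Tonelli needs no measurability, and it is applied to integrands translated by an
arbitrary, possibly non-measurable, rule. -/
lemma lintegral_pi_fin_succ_le {E : Type*} [MeasurableSpace E] {N : ℕ} (ν : Measure E)
    [SigmaFinite ν] (f : (Fin (N + 1) → E) → ENNReal) :
    ∫⁻ ω, f ω ∂(Measure.pi fun _ => ν) ≤
      ∫⁻ x, ∫⁻ ω, f (Fin.cons x ω) ∂(Measure.pi fun _ : Fin N => ν) ∂ν := by
  have h := (measurePreserving_piFinSuccAbove (fun _ : Fin (N + 1) => ν) 0).symm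
  rw [MeasurePreserving.lintegral_map_equiv f _ h]
  refine (lintegral_prod_le _).trans_eq ?_
  simp [MeasurableEquiv.piFinSuccAbove_symm_apply, Fin.insertNthEquiv]

lemma lintegral_pi_fin_succ {E : Type*} [MeasurableSpace E] {N : ℕ} (ν : Measure E)
    [SigmaFinite ν] {f : (Fin (N + 1) → E) → ENNReal} (hf : Measurable f) :
    ∫⁻ ω, f ω ∂(Measure.pi fun _ => ν) =
      ∫⁻ x, ∫⁻ ω, f (Fin.cons x ω) ∂(Measure.pi fun _ : Fin N => ν) ∂ν := by
  have h := (measurePreserving_piFinSuccAbove (fun _ : Fin (N + 1) => ν) 0).symm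
  rw [MeasurePreserving.lintegral_map_equiv f _ h, lintegral_prod]
  · simp [MeasurableEquiv.piFinSuccAbove_symm_apply, Fin.insertNthEquiv]
  · exact (hf.comp (MeasurableEquiv.measurable _)).aemeasurable

lemma measurable_fin_cons {E : Type*} [MeasurableSpace E] {N : ℕ} :
    Measurable fun z : E × (Fin N → E) => (Fin.cons z.1 z.2 : Fin (N + 1) → E) := by
  refine measurable_pi_iff.2 fun i => ?_
  refine Fin.cases ?_ (fun j => ?_) i
  · simpa using measurable_fst
  · simpa [Function.comp_def] using (measurable_pi_apply j).comp measurable_snd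

/-- Translating a sequence of independent noises by amounts that may depend on the earlier
noises. -/
lemma ShiftBound.pi {E : Type*} [MeasurableSpace E] [AddCommMonoid E] {ν : Measure E}
    [IsProbabilityMeasure ν] {q : ℝ} (hq : 0 < q) {κ : E → ℝ} (hκ : ShiftBound ν q κ)
    {N : ℕ} (s : (Fin N → E) → Fin N → E)
    (hs : ∀ i ω ω', (∀ j < i, ω j = ω' j) → s ω i = s ω' i) {B : ℝ}
    (hB : ∀ ω, ∑ i, κ (s ω i) ≤ B) {g : (Fin N → E) → ENNReal} (hg : Measurable g) :
    ∫⁻ ω, g (ω + s ω) ∂(Measure.pi fun _ => ν) ≤ ENNReal.ofReal (Real.exp B) *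
      (∫⁻ ω, g ω ^ q ∂(Measure.pi fun _ => ν)) ^ (1 / q) := by
  induction N generalizing B with
  | zero =>
    have h0 : 0 ≤ B := by simpa using hB fun i => i.elim0
    rw [Measure.pi_of_empty (fun _ : Fin 0 => ν), lintegral_dirac, lintegral_dirac,
      ← ENNReal.rpow_mul, mul_one_div_cancel hq.ne', ENNReal.rpow_one, Subsingleton.elim (_ + _)]
    refine le_mul_of_one_le_left zero_le ?_
    rw [← ENNReal.ofReal_one]
    exact ENNReal.ofReal_le_ofReal (Real.one_le_exp h0)
  | succ N ih =>
    set s0 : E := s (fun _ => 0) 0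
    have hs0 : ∀ ω, s ω 0 = s0 := fun ω => hs 0 _ _ fun j hj => absurd hj (Fin.not_lt_zero j)
    -- The L^q norm over the later noises as a function of the first one: its own L^q norm is the
    -- full one, so splitting off a coordinate loses nothing.
    let h : E → ENNReal := fun z =>
      (∫⁻ ω, g (Fin.cons z ω) ^ q ∂(Measure.pi fun _ : Fin N => ν)) ^ (1 / q)
    have hgc : Measurable fun z : E × (Fin N → E) => g (Fin.cons z.1 z.2) ^ q :=
      (hg.comp measurable_fin_cons).pow_const q
    have hh : Measurable h := hgc.lintegral_prod_right'.pow_const _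
    have hinner : ∀ x, ∫⁻ ω, g (Fin.cons x ω + s (Fin.cons x ω)) ∂(Measure.pi fun _ : Fin N => ν)
        ≤ ENNReal.ofReal (Real.exp (B - κ s0)) * h (x + s0) := by
      intro x
      have := ih (fun ω i => s (Fin.cons x ω) i.succ) (B := B - κ s0) ?_ ?_
        (g := fun ω => g (Fin.cons (x + s0) ω)) ?_
      · refine le_trans (le_of_eq (lintegral_congr fun ω => ?_)) this
        congr 1
        funext i
        refine Fin.cases ?_ (fun j => ?_) i
        · simp [hs0]
        · simp
      · intro i ω ω' hω
        refine hs _ _ _ fun j hj => ?_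
        revert hj
        refine Fin.cases (fun _ => rfl) (fun j hj => ?_) j
        simpa using hω j (Fin.succ_lt_succ_iff.1 hj)
      · intro ω
        have := hB (Fin.cons x ω)
        rw [Fin.sum_univ_succ, hs0] at this
        linarith
      · exact hg.comp (measurable_fin_cons.comp (measurable_const.prodMk measurable_id))
    calc ∫⁻ ω, g (ω + s ω) ∂(Measure.pi fun _ => ν)
        ≤ ∫⁻ x, ∫⁻ ω, g (Fin.cons x ω + s (Fin.cons x ω)) ∂(Measure.pi fun _ : Fin N => ν) ∂ν :=
          lintegral_pi_fin_succ_le ν _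
      _ ≤ ∫⁻ x, ENNReal.ofReal (Real.exp (B - κ s0)) * h (x + s0) ∂ν := lintegral_mono hinner
      _ = ENNReal.ofReal (Real.exp (B - κ s0)) * ∫⁻ x, h (x + s0) ∂ν :=
          lintegral_const_mul' _ _ ENNReal.ofReal_ne_top
      _ ≤ ENNReal.ofReal (Real.exp (B - κ s0)) *
          (ENNReal.ofReal (Real.exp (κ s0)) * (∫⁻ x, h x ^ q ∂ν) ^ (1 / q)) := by
          gcongr
          exact hκ s0 h hh
      _ = _ := by
          rw [← mul_assoc, ← ENNReal.ofReal_mul (Real.exp_pos _).le, ← Real.exp_add,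
            sub_add_cancel, lintegral_pi_fin_succ ν (hg.pow_const q)]
          congr 2
          refine lintegral_congr fun x => ?_
          rw [← ENNReal.rpow_mul, one_div_mul_cancel hq.ne', ENNReal.rpow_one]

lemma lintegral_pi_prod_le {E : Type*} [MeasurableSpace E] {N : ℕ} (ν : Measure E)
    [IsProbabilityMeasure ν] (f : Fin N → E → ENNReal) (hf : ∀ i, Measurable (f i)) :
    ∫⁻ ω, ∏ i, f i (ω i) ∂(Measure.pi fun _ => ν) ≤ ∏ i, ∫⁻ x, f i x ∂ν := by
  induction N with
  | zero => simp
  | succ N ih =>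
    refine (lintegral_pi_fin_succ_le ν _).trans ?_
    simp only [Fin.prod_univ_succ, Fin.cons_zero, Fin.cons_succ]
    have hm : Measurable fun ω : Fin N → E => ∏ i, f i.succ (ω i) :=
      Finset.measurable_prod _ fun i _ => (hf i.succ).comp (measurable_pi_apply i)
    simp only [lintegral_const_mul _ hm]
    rw [lintegral_mul_const _ (hf 0)]
    gcongr
    exact ih _ fun i => hf i.succ

/-! ### Released noise -/

lemma clearBits_le (t i : ℕ) : clearBits t i ≤ t := Nat.div_mul_le_self t _

lemma clearBits_pos {t i : ℕ} (h : t.testBit i = true) : 0 < clearBits t i := by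
  rw [testBit_iff] at h
  refine Nat.mul_pos (Nat.pos_of_ne_zero fun h0 => ?_) (by positivity)
  simp [h0] at h

lemma clearBits_succ_bit {t i : ℕ} (h : t.testBit i = true) :
    clearBits t i - 2 ^ i = clearBits t (i + 1) := by
  rw [testBit_iff] at h
  unfold clearBits
  rw [pow_succ, ← Nat.div_div_eq_div_mul, mul_comm (2 ^ i) 2, ← mul_assoc,
    ← Nat.sub_one_mul]
  congr 1
  omega

lemma clearBits_succ_of_not {t i : ℕ} (h : ¬ t.testBit i = true) :
    clearBits t (i + 1) = clearBits t i := by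
  rw [testBit_iff] at h
  unfold clearBits
  rw [pow_succ, ← Nat.div_div_eq_div_mul, mul_comm (2 ^ i) 2, ← mul_assoc]
  congr 1
  omega

lemma padicValNat_clearBits {t i : ℕ} (h : t.testBit i = true) :
    padicValNat 2 (clearBits t i) = i := by
  have h1 := (testBit_iff _ _).1 h
  unfold clearBits
  rw [padicValNat.mul (by omega) (by positivity), padicValNat.prime_pow,
    padicValNat.eq_zero_of_not_dvd (by omega), zero_add]

lemma clearBits_size (t : ℕ) : clearBits t t.size = 0 := by
  simp [clearBits, Nat.div_eq_of_lt (Nat.lt_size_self t)]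

/-- Increments over the dyadic blocks add up to the total increment. -/
lemma releasedNoise_increments (d : ℕ → ℝ) (t : ℕ) :
    releasedNoise (fun i => d (i + 1) - d (i + 1 - 2 ^ padicValNat 2 (i + 1))) t = d t - d 0 := by
  have h0 : clearBits t 0 = t := by simp [clearBits]
  have key := Finset.sum_range_sub' (fun i => d (clearBits t i)) t.size
  rw [clearBits_size, h0] at key
  rw [← key, releasedNoise, Finset.sum_filter]
  refine Finset.sum_congr rfl fun i _ => ?_
  split_ifs with h
  · rw [Nat.sub_add_cancel (clearBits_pos h), padicValNat_clearBits h, clearBits_succ_bit h]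
  · rw [clearBits_succ_of_not h, sub_self]

lemma releasedNoise_add (y z : ℕ → ℝ) (t : ℕ) :
    releasedNoise (fun i => y i + z i) t = releasedNoise y t + releasedNoise z t := by
  simp only [releasedNoise, Finset.sum_add_distrib]

lemma releasedNoise_congr {y z : ℕ → ℝ} {t : ℕ} (h : ∀ i < t, y i = z i) :
    releasedNoise y t = releasedNoise z t := by
  refine Finset.sum_congr rfl fun i hi => h _ ?_
  have h1 := clearBits_pos (Finset.mem_filter.1 hi).2
  have h2 := clearBits_le t i
  omega

lemma measurable_releasedNoise {Ω : Type*} [MeasurableSpace Ω] {y : Ω → ℕ → ℝ}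
    (hy : ∀ i, Measurable fun ω => y ω i) (t : ℕ) : Measurable fun ω => releasedNoise (y ω) t :=
  Finset.measurable_sum _ fun _ _ => hy _

/-! ### Measurability of the algorithm -/

/-- The discrete states are countable, so the event is a countable union over the preceding state
and the set of under-enrolled schools, each fixed by inequalities between measurable functions. -/
lemma measurableSet_run_eq {Ω : Type*} [MeasurableSpace Ω] {n m J : ℕ} (k : ℕ)
    (sel : SelectionRule m) (C : Fin m → ℕ) (E : ℝ) (D : Database n m J)
    {y : Ω → ℕ → Fin m → ℝ} (hy : ∀ i u, Measurable fun ω => y ω i u) (r : ℕ) (x : Core n m) :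
    MeasurableSet {ω | Core.run k sel C E D (y ω) r = x} := by
  induction r generalizing x with
  | zero => exact MeasurableSet.const (Core.init n m J = x)
  | succ r ih =>
    have hU : ∀ (z : Core n m) (U : Finset (Fin m)),
        MeasurableSet {ω | z.under C E (y ω) = U} := by
      intro z U
      have : {ω | z.under C E (y ω) = U} = ⋂ u, {ω | ((z.load u : ℝ) +
          releasedNoise (fun i => y ω i u) (z.2.2 * n) < (C u : ℝ) - E ∧ 0 < z.1 u) ↔ u ∈ U} := by
        ext ω
        simp [Core.under, Finset.ext_iff]
      rw [this]
      refine MeasurableSet.iInter fun u => ?_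
      have h1 : MeasurableSet {ω | (z.load u : ℝ) +
          releasedNoise (fun i => y ω i u) (z.2.2 * n) < (C u : ℝ) - E} :=
        measurableSet_lt (measurable_const.add (measurable_releasedNoise (fun i => hy i u) _))
          measurable_const
      have h2 := h1.inter (MeasurableSet.const (0 < z.1 u))
      by_cases hu : u ∈ U
      · simp only [hu, iff_true]
        exact h2
      · simp only [hu, iff_false]
        exact h2.compl
    have : {ω | Core.run k sel C E D (y ω) (r + 1) = x} = ⋃ (z : Core n m), ⋃ (U : Finset (Fin m)),
        {ω | Core.run k sel C E D (y ω) r = z} ∩ {ω | z.under C E (y ω) = U} ∩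
          {_ω | Core.step k sel D U z = x} := by
      ext ω
      simp [Core.run_succ]
    rw [this]
    exact MeasurableSet.iUnion fun z => MeasurableSet.iUnion fun U =>
      ((ih z).inter (hU z U)).inter (MeasurableSet.const _)

lemma measurable_noiseAt {N m : ℕ} (i : ℕ) (u : Fin m) :
    Measurable fun ω : Fin N → Fin m → ℝ => noiseAt ω i u := by
  unfold noiseAt
  by_cases h : i < N
  · simp only [h, dif_pos]
    exact (measurable_pi_apply u).comp (measurable_pi_apply _)
  · simp [h]

lemma measurable_runDA {N n m J : ℕ} (k : ℕ) (sel : SelectionRule m) (C : Fin m → ℕ) (E : ℝ)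
    (D : Database n m J) :
    Measurable fun ω : Fin N → Fin m → ℝ => runDA k sel C E D (noiseAt ω) := by
  refine measurable_to_countable' fun t => ?_
  have : (fun ω : Fin N → Fin m → ℝ => runDA k sel C E D (noiseAt ω)) ⁻¹' {t} =
      ⋃ (s : (Fin n → Option (Fin m) × ℕ) × ℕ),
        {ω | Core.run k sel C E D (noiseAt ω) (m * J) = (t, s)} := by
    ext ω
    simp only [Set.mem_preimage, Set.mem_singleton_iff, runDA_eq_run, Set.mem_iUnion,
      Set.mem_ofPred_eq]
    exact ⟨fun h => ⟨_, Prod.ext h rfl⟩, fun ⟨s, hs⟩ => by rw [hs]⟩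
  rw [this]
  exact MeasurableSet.iUnion fun s =>
    measurableSet_run_eq k sel C E D (fun i u => measurable_noiseAt i u) _ _

instance {n m J : ℕ} (ε' : ℝ) : IsProbabilityMeasure (noiseLaw n m J ε') := by
  unfold noiseLaw
  infer_instance

lemma isProbabilityMeasure_privateDA {n m J : ℕ} (k : ℕ) (sel : SelectionRule m)
    (C : Fin m → ℕ) (ε₀ δ β : ℝ) (D : Database n m J) :
    IsProbabilityMeasure (privateDA k sel C ε₀ δ β D) :=
  Measure.isProbabilityMeasure_map (measurable_runDA k sel C _ D).aemeasurable

/-! ### Coupled runs -/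

/-- The run on `D` with the noise `y`, together with a run on `D'` that lowers the same
thresholds. -/
def pairRun {n m J : ℕ} (k : ℕ) (sel : SelectionRule m) (C : Fin m → ℕ) (E : ℝ)
    (D D' : Database n m J) (y : ℕ → Fin m → ℝ) (r : ℕ) : Core n m × Core n m :=
  (fun z => (Core.step k sel D (z.1.under C E y) z.1, Core.step k sel D' (z.1.under C E y) z.2))^[r]
    (Core.init n m J, Core.init n m J)

section PairRun

variable {n m J : ℕ} (k : ℕ) (sel : SelectionRule m) (C : Fin m → ℕ) (E : ℝ)
  (D D' : Database n m J) (y : ℕ → Fin m → ℝ)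

lemma pairRun_succ (r : ℕ) : pairRun k sel C E D D' y (r + 1) =
    (Core.step k sel D ((pairRun k sel C E D D' y r).1.under C E y) (pairRun k sel C E D D' y r).1,
      Core.step k sel D' ((pairRun k sel C E D D' y r).1.under C E y)
        (pairRun k sel C E D D' y r).2) := by
  simp only [pairRun, Function.iterate_succ_apply']

lemma pairRun_fst (r : ℕ) : (pairRun k sel C E D D' y r).1 = Core.run k sel C E D y r := by
  induction r with
  | zero => rfl
  | succ r ih => rw [pairRun_succ, Core.run_succ, ih]

variable {k sel D D'}

lemma Core.step_of_nonempty {U : Finset (Fin m)} (hU : U.Nonempty) (x : Core n m) :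
    Core.step k sel D U x = (lower x.1 (sel.pick x.1 U),
      fun a => studentStep k (D a) (lower x.1 (sel.pick x.1 U)) (x.2.1 a), x.2.2 + 1) :=
  if_pos hU

lemma Core.step_empty (x : Core n m) : Core.step k sel D ∅ x = x := by
  simp [Core.step]

variable (k sel D D')

/-- Passes and iterations agree until the loop ends, after which the state is frozen. This
identifies the state at iteration r with the one that `loadDiff` reads at the counters' current
time. -/
lemma pairRun_pass (r : ℕ) :
    ((pairRun k sel C E D D' y r).1.2.2 = r ∨
      (pairRun k sel C E D D' y r).1.under C E y = ∅) ∧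
    (pairRun k sel C E D D' y r).1.2.2 ≤ r ∧
    ∀ j, (pairRun k sel C E D D' y r).1.2.2 ≤ j → j ≤ r →
      pairRun k sel C E D D' y j = pairRun k sel C E D D' y r := by
  induction r with
  | zero =>
    refine ⟨Or.inl rfl, le_rfl, fun j _ hj => ?_⟩
    rw [Nat.le_zero.1 hj]
  | succ r ih =>
    obtain ⟨h1, h2, h3⟩ := ih
    rcases Finset.eq_empty_or_nonempty ((pairRun k sel C E D D' y r).1.under C E y) with hU | hU
    · have hs : pairRun k sel C E D D' y (r + 1) = pairRun k sel C E D D' y r := by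
        rw [pairRun_succ, hU, Core.step_empty, Core.step_empty]
      rw [hs]
      refine ⟨Or.inr hU, by omega, fun j hj hj' => ?_⟩
      rcases hj'.lt_or_eq with h | h
      · exact h3 j hj (by omega)
      · rw [h, hs]
    · have hp := h1.resolve_right hU.ne_empty
      have hs : (pairRun k sel C E D D' y (r + 1)).1.2.2 = r + 1 := by
        rw [pairRun_succ, Core.step_of_nonempty hU, hp]
      rw [hs]
      refine ⟨Or.inl rfl, le_rfl, fun j hj hj' => ?_⟩
      rw [le_antisymm hj' hj]

variable {D D'}

lemma pairRun_eq {a : Fin n} (h : ∀ b, b ≠ a → D b = D' b) (r : ℕ) :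
    (pairRun k sel C E D D' y r).1.1 = (pairRun k sel C E D D' y r).2.1 ∧
    (pairRun k sel C E D D' y r).1.2.2 = (pairRun k sel C E D D' y r).2.2.2 ∧
    ∀ b, b ≠ a →
      (pairRun k sel C E D D' y r).1.2.1 b = (pairRun k sel C E D D' y r).2.2.1 b := by
  induction r with
  | zero => exact ⟨rfl, rfl, fun _ _ => rfl⟩
  | succ r ih =>
    obtain ⟨h1, h2, h3⟩ := ih
    rw [pairRun_succ]
    rcases Finset.eq_empty_or_nonempty ((pairRun k sel C E D D' y r).1.under C E y) with hU | hU
    · rw [hU, Core.step_empty, Core.step_empty]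
      exact ⟨h1, h2, h3⟩
    · rw [Core.step_of_nonempty hU, Core.step_of_nonempty hU]
      refine ⟨by simp only [h1], by simp only [h2], fun b hb => ?_⟩
      simp only [h1, h3 b hb, h b hb]

variable (D D') {y}

lemma Core.under_congr {y' : ℕ → Fin m → ℝ} (x : Core n m) (h : ∀ i < x.2.2 * n, y i = y' i) :
    x.under C E y = x.under C E y' := by
  unfold Core.under
  refine Finset.filter_congr fun u _ => ?_
  rw [releasedNoise_congr (z := fun i => y' i u) fun i hi => by rw [h i hi]]

/-- The decision for pass r is taken before that pass is streamed, so it sees the noise of the first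
r - 1 passes only. -/
lemma pairRun_congr {y' : ℕ → Fin m → ℝ} (r : ℕ) (h : ∀ i < (r - 1) * n, y i = y' i) :
    pairRun k sel C E D D' y r = pairRun k sel C E D D' y' r := by
  induction r with
  | zero => rfl
  | succ r ih =>
    have hr := ih fun i hi => h i (hi.trans_le (Nat.mul_le_mul_right n (by omega)))
    rw [pairRun_succ, pairRun_succ, ← hr, Core.under_congr C E _ fun i hi => h i ?_]
    refine hi.trans_le (Nat.mul_le_mul_right n ?_)
    have := (pairRun_pass k sel C E D D' y r).2.1
    omega

variable (y)

/-- The difference of the numbers of students at `u` in the coupled runs, after all passes that are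
complete at time `t`. -/
def loadDiff (t : ℕ) (u : Fin m) : ℝ :=
  ((pairRun k sel C E D D' y (t / n)).1.load u : ℝ) - (pairRun k sel C E D D' y (t / n)).2.load u

/-- The amount by which the noise at time `i` has to be translated for the run on `D'` to follow the
run on `D`. -/
def noiseShift (i : ℕ) (u : Fin m) : ℝ :=
  loadDiff k sel C E D D' y (i + 1) u -
    loadDiff k sel C E D D' y (i + 1 - 2 ^ padicValNat 2 (i + 1)) u

variable {D D'}

/-- At the end of each pass the translations released by a counter add up to the load difference, so
both runs display equal values and lower the same threshold. -/
lemma pairRun_snd (hn : 0 < n) {a : Fin n} (h : ∀ b, b ≠ a → D b = D' b) {y' : ℕ → Fin m → ℝ}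
    {R : ℕ} (hy : ∀ i < R * n, ∀ u, y' i u = y i u + noiseShift k sel C E D D' y i u)
    (r : ℕ) (hr : r ≤ R) :
    (pairRun k sel C E D D' y r).2 = Core.run k sel C E D' y' r := by
  induction r with
  | zero => rfl
  | succ r ih =>
    have ih := ih (by omega)
    have hU : (Core.run k sel C E D' y' r).under C E y' =
        (pairRun k sel C E D D' y r).1.under C E y := by
      rw [← ih]
      obtain ⟨h1, h2, -⟩ := pairRun_eq k sel C E y h r
      obtain ⟨-, hp1, hp2⟩ := pairRun_pass k sel C E D D' y r
      unfold Core.under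
      refine Finset.filter_congr fun u _ => ?_
      rw [← h1, ← h2]
      have hrel : releasedNoise (fun i => y' i u)
          ((pairRun k sel C E D D' y r).1.2.2 * n) =
          releasedNoise (fun i => y i u) ((pairRun k sel C E D D' y r).1.2.2 * n) +
            (((pairRun k sel C E D D' y r).1.load u : ℝ) -
              (pairRun k sel C E D D' y r).2.load u) := by
        rw [releasedNoise_congr (z := fun i => y i u + noiseShift k sel C E D D' y i u) fun i hi =>
          hy i (hi.trans_le (Nat.mul_le_mul_right n (by omega))) u, releasedNoise_add]
        congr 1
        refine (releasedNoise_increments (fun t => loadDiff k sel C E D D' y t u) _).trans ?_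
        have h0 : loadDiff k sel C E D D' y 0 u = 0 := by
          simp [loadDiff, pairRun]
        rw [h0, sub_zero, loadDiff, Nat.mul_div_cancel _ hn, hp2 _ le_rfl hp1]
      rw [hrel]
      refine and_congr_left fun _ => ?_
      constructor <;> intro hlt <;> linarith
    rw [pairRun_succ, Core.run_succ, hU, ih]

lemma loadDiff_congr {y' : ℕ → Fin m → ℝ} (t : ℕ) (h : ∀ i, i + 1 < t → y i = y' i) (hn : 0 < n) :
    loadDiff k sel C E D D' y t = loadDiff k sel C E D D' y' t := by
  funext u
  unfold loadDiff
  rw [pairRun_congr k sel C E D D' (y' := y') (t / n) fun i hi => h i ?_]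
  rw [Nat.sub_one_mul] at hi
  have := Nat.div_mul_le_self t n
  omega

/-- The translation is predictable, as `ShiftBound.pi` requires. -/
lemma noiseShift_congr {y' : ℕ → Fin m → ℝ} (i : ℕ) (h : ∀ j < i, y j = y' j) (hn : 0 < n) :
    noiseShift k sel C E D D' y i = noiseShift k sel C E D D' y' i := by
  funext u
  have hpos : 0 < 2 ^ padicValNat 2 (i + 1) := by positivity
  unfold noiseShift
  rw [loadDiff_congr k sel C E y (y' := y') (i + 1) (fun j hj => h j (by omega)) hn,
    loadDiff_congr k sel C E y (y' := y') (i + 1 - 2 ^ padicValNat 2 (i + 1))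
      (fun j hj => h j (by omega)) hn]

/-! ### The size of the translations -/

/-- Blocks of one level are disjoint, so their increments sum to at most the total growth B; there
are log₂ N + 1 levels. -/
lemma sum_dyadic_increments_le {A : ℕ → ℕ} (hA : Monotone A) {B : ℕ} (hB : ∀ t, A t ≤ B) (N : ℕ) :
    ∑ i ∈ Finset.range N, (A (i + 1) - A (i + 1 - 2 ^ padicValNat 2 (i + 1))) ≤
      (Nat.log 2 N + 1) * B := by
  classical
  have hmaps : ∀ i ∈ Finset.range N, padicValNat 2 (i + 1) ∈ Finset.range (Nat.log 2 N + 1) := by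
    intro i hi
    rw [Finset.mem_range] at hi ⊢
    have := padicValNat_le_nat_log (p := 2) (i + 1)
    have := Nat.log_mono_right (b := 2) (show i + 1 ≤ N by omega)
    omega
  rw [← Finset.sum_fiberwise_of_maps_to hmaps]
  refine (Finset.sum_le_card_nsmul _ _ B fun j _ => ?_).trans_eq (by simp)
  have hdvd : ∀ i, padicValNat 2 (i + 1) = j → ((i + 1) / 2 ^ j - 1 + 1) * 2 ^ j = i + 1 := by
    intro i hi
    have hd : 2 ^ j ∣ i + 1 := hi ▸ pow_padicValNat_dvd
    have hpos : 0 < (i + 1) / 2 ^ j :=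
      Nat.div_pos (Nat.le_of_dvd (by omega) hd) (by positivity)
    rw [Nat.sub_add_cancel hpos, Nat.div_mul_cancel hd]
  have hle : ∑ i ∈ (Finset.range N).filter (fun i => padicValNat 2 (i + 1) = j),
      (A (i + 1) - A (i + 1 - 2 ^ padicValNat 2 (i + 1))) ≤
      ∑ q ∈ Finset.range N, (A ((q + 1) * 2 ^ j) - A (q * 2 ^ j)) := by
    have hinj : Set.InjOn (fun i => (i + 1) / 2 ^ j - 1)
        ((Finset.range N).filter fun i => padicValNat 2 (i + 1) = j) := by
      intro i hi i' hi' he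
      have h1 := hdvd i (Finset.mem_filter.1 hi).2
      have h2 := hdvd i' (Finset.mem_filter.1 hi').2
      simp only at he
      rw [he, h2] at h1
      omega
    have hsum := Finset.sum_image (f := fun q => A ((q + 1) * 2 ^ j) - A (q * 2 ^ j)) hinj
    rw [Finset.sum_congr rfl (g := fun i => A (((i + 1) / 2 ^ j - 1 + 1) * 2 ^ j) -
      A (((i + 1) / 2 ^ j - 1) * 2 ^ j)), ← hsum]
    · refine Finset.sum_le_sum_of_subset fun q hq => ?_
      obtain ⟨i, hi, rfl⟩ := Finset.mem_image.1 hq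
      have := Finset.mem_range.1 (Finset.mem_filter.1 hi).1
      have := Nat.div_le_self (i + 1) (2 ^ j)
      rw [Finset.mem_range]
      omega
    · intro i hi
      have hj := (Finset.mem_filter.1 hi).2
      rw [hdvd i hj, hj]
      congr 2
      have := hdvd i hj
      rw [add_mul, one_mul] at this
      omega
  refine hle.trans ?_
  rw [Finset.sum_range_tsub (f := fun q => A (q * 2 ^ j))
    (fun a b hab => hA (Nat.mul_le_mul_right _ hab))]
  exact (Nat.sub_le _ _).trans (hB _)

lemma studentStep_spec (s : Student m J) (t : Fin m → ℕ) (x : Option (Fin m) × ℕ) :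
    x.2 ≤ (studentStep k s t x).2 ∧
      ((studentStep k s t x).2 = x.2 → studentStep k s t x = x) ∧
      (x.2 ≤ k → (studentStep k s t x).2 ≤ k) := by
  unfold studentStep
  split_ifs with h
  · refine ⟨by simp, fun h' => by simp at h', fun _ => h.1⟩
  · exact ⟨le_rfl, fun _ => rfl, fun h => h⟩

end PairRun

/-- The history `X` of a student (match, number of accepted proposals): the match changes only when
a proposal is accepted, which happens at most `k` times. -/
structure IsHistory {m : ℕ} (k : ℕ) (X : ℕ → Option (Fin m) × ℕ) : Prop where
  mono : Monotone fun r => (X r).2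
  le : ∀ r, (X r).2 ≤ k
  eq : ∀ r r', r ≤ r' → (X r).2 = (X r').2 → X r = X r'

lemma isHistory_of_step {m : ℕ} {k : ℕ} {X : ℕ → Option (Fin m) × ℕ} (h0 : (X 0).2 ≤ k)
    (h : ∀ r, (X r).2 ≤ (X (r + 1)).2 ∧ ((X (r + 1)).2 = (X r).2 → X (r + 1) = X r) ∧
      ((X r).2 ≤ k → (X (r + 1)).2 ≤ k)) : IsHistory k X := by
  have hmono : Monotone fun r => (X r).2 := monotone_nat_of_le_succ fun r => (h r).1
  refine ⟨hmono, fun r => ?_, fun r r' hr => ?_⟩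
  · induction r with
    | zero => exact h0
    | succ r ih => exact (h r).2.2 ih
  · induction r', hr using Nat.le_induction with
    | base => exact fun _ => rfl
    | succ r' hr ih =>
      intro he
      have h1 : (X r).2 ≤ (X r').2 := hmono hr
      have h2 := (h r').1
      rw [(h r').2.1 (by omega)]
      exact ih (by omega)

/-- The indicator of the event that the match is the school `u`. -/
def seat {m : ℕ} (x : Option (Fin m) × ℕ) (u : Fin m) : ℝ := if x.1 = some u then 1 else 0

lemma seat_nonneg {m : ℕ} (x : Option (Fin m) × ℕ) (u : Fin m) : 0 ≤ seat x u := by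
  unfold seat; split_ifs <;> norm_num

lemma seat_le_one {m : ℕ} (x : Option (Fin m) × ℕ) (u : Fin m) : seat x u ≤ 1 := by
  unfold seat; split_ifs <;> norm_num

lemma sum_seat_le_one {m : ℕ} (x : Option (Fin m) × ℕ) : ∑ u, seat x u ≤ 1 := by
  unfold seat
  obtain ⟨x, -⟩ := x
  cases x <;> simp

/-- Each seat vector has at most one unit entry, so a change has square norm at most 2, and any
change requires an accepted proposal. -/
lemma IsHistory.sum_sq_le {m : ℕ} {k : ℕ} {X : ℕ → Option (Fin m) × ℕ} (h : IsHistory k X)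
    {r r' : ℕ} (hr : r ≤ r') :
    ∑ u, (seat (X r') u - seat (X r) u) ^ 2 ≤ 2 * (((X r').2 - (X r).2 : ℕ) : ℝ) := by
  rcases (h.mono hr).lt_or_eq with hlt | heq
  · have h1 : ∑ u, (seat (X r') u - seat (X r) u) ^ 2 ≤ ∑ u, (seat (X r') u + seat (X r) u) := by
      refine Finset.sum_le_sum fun u _ => ?_
      have := seat_nonneg (X r) u
      have := seat_nonneg (X r') u
      have := seat_le_one (X r) u
      have := seat_le_one (X r') u
      nlinarith
    rw [Finset.sum_add_distrib] at h1
    have h2 := sum_seat_le_one (X r)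
    have h3 := sum_seat_le_one (X r')
    have h4 : (1 : ℝ) ≤ ((X r').2 - (X r).2 : ℕ) := by
      have : 1 ≤ (X r').2 - (X r).2 := by simp only at hlt; omega
      exact_mod_cast this
    linarith
  · rw [h.eq r r' hr heq]
    simp

section PairRun

variable {n m J : ℕ} (k : ℕ) (sel : SelectionRule m) (C : Fin m → ℕ) (E : ℝ)
  (D D' : Database n m J) (y : ℕ → Fin m → ℝ)

lemma step_student (D : Database n m J) (U : Finset (Fin m)) (x : Core n m) (a : Fin n) :
    (x.2.1 a).2 ≤ ((Core.step k sel D U x).2.1 a).2 ∧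
      (((Core.step k sel D U x).2.1 a).2 = (x.2.1 a).2 →
        (Core.step k sel D U x).2.1 a = x.2.1 a) ∧
      ((x.2.1 a).2 ≤ k → ((Core.step k sel D U x).2.1 a).2 ≤ k) := by
  rcases Finset.eq_empty_or_nonempty U with hU | hU
  · rw [hU, Core.step_empty]
    exact ⟨le_rfl, fun _ => rfl, fun h => h⟩
  · rw [Core.step_of_nonempty hU]
    exact studentStep_spec k (D a) _ (x.2.1 a)

lemma isHistory_fst (a : Fin n) :
    IsHistory k fun r => (pairRun k sel C E D D' y r).1.2.1 a :=
  isHistory_of_step (Nat.zero_le _) fun r => by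
    rw [pairRun_succ]
    exact step_student k sel D _ _ a

lemma isHistory_snd (a : Fin n) :
    IsHistory k fun r => (pairRun k sel C E D D' y r).2.2.1 a :=
  isHistory_of_step (Nat.zero_le _) fun r => by
    rw [pairRun_succ]
    exact step_student k sel D' _ _ a

lemma Core.load_eq_sum (x : Core n m) (u : Fin m) :
    (x.load u : ℝ) = ∑ b, seat (x.2.1 b) u := by
  have := card_enrolled_eq_sum (fun a => (x.2.1 a).1) u
  have h2 := congrArg (Int.cast : ℤ → ℝ) this
  push_cast at h2
  exact h2

variable {D D'}

lemma loadDiff_eq {a : Fin n} (h : ∀ b, b ≠ a → D b = D' b) (t : ℕ) (u : Fin m) :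
    loadDiff k sel C E D D' y t u =
      seat ((pairRun k sel C E D D' y (t / n)).1.2.1 a) u -
        seat ((pairRun k sel C E D D' y (t / n)).2.2.1 a) u := by
  unfold loadDiff
  rw [Core.load_eq_sum, Core.load_eq_sum, ← Finset.sum_sub_distrib]
  refine Finset.sum_eq_single a (fun b _ hb => ?_) (by simp)
  rw [(pairRun_eq k sel C E y h _).2.2 b hb, sub_self]

/-- The 8 is 2 from the square of a difference, 2 from `IsHistory.sum_sq_le`, and 2 for the two
runs. -/
lemma sum_sq_noiseShift_le {a : Fin n} (h : ∀ b, b ≠ a → D b = D' b) (N : ℕ) :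
    ∑ i ∈ Finset.range N, ∑ u, noiseShift k sel C E D D' y i u ^ 2 ≤
      8 * k * (Nat.log 2 N + 1) := by
  set X := fun r => (pairRun k sel C E D D' y r).1.2.1 a
  set X' := fun r => (pairRun k sel C E D D' y r).2.2.1 a
  have hX : IsHistory k X := isHistory_fst k sel C E D D' y a
  have hX' : IsHistory k X' := isHistory_snd k sel C E D D' y a
  have hi : ∀ i, ∑ u, noiseShift k sel C E D D' y i u ^ 2 ≤
      4 * (((X ((i + 1) / n)).2 - (X ((i + 1 - 2 ^ padicValNat 2 (i + 1)) / n)).2 : ℕ) : ℝ) +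
      4 * (((X' ((i + 1) / n)).2 - (X' ((i + 1 - 2 ^ padicValNat 2 (i + 1)) / n)).2 : ℕ) : ℝ) := by
    intro i
    have hr : (i + 1 - 2 ^ padicValNat 2 (i + 1)) / n ≤ (i + 1) / n :=
      Nat.div_le_div_right (Nat.sub_le _ _)
    have h1 := hX.sum_sq_le hr
    have h2 := hX'.sum_sq_le hr
    have h3 : ∑ u, noiseShift k sel C E D D' y i u ^ 2 ≤
        ∑ u, (2 * (seat (X ((i + 1) / n)) u -
            seat (X ((i + 1 - 2 ^ padicValNat 2 (i + 1)) / n)) u) ^ 2 +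
          2 * (seat (X' ((i + 1) / n)) u -
            seat (X' ((i + 1 - 2 ^ padicValNat 2 (i + 1)) / n)) u) ^ 2) := by
      refine Finset.sum_le_sum fun u _ => ?_
      unfold noiseShift
      rw [loadDiff_eq k sel C E y h, loadDiff_eq k sel C E y h]
      have key : ∀ p q p' q' : ℝ,
          (p - q - (p' - q')) ^ 2 ≤ 2 * (p - p') ^ 2 + 2 * (q - q') ^ 2 := by
        intro p q p' q'
        nlinarith [sq_nonneg (p - p' + (q - q'))]
      exact key _ _ _ _
    rw [Finset.sum_add_distrib, ← Finset.mul_sum, ← Finset.mul_sum] at h3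
    linarith
  have hdiv : Monotone fun t : ℕ => t / n := fun s t hst => Nat.div_le_div_right hst
  have hA := sum_dyadic_increments_le (hX.mono.comp hdiv) (fun t => hX.le _) N
  have hA' := sum_dyadic_increments_le (hX'.mono.comp hdiv) (fun t => hX'.le _) N
  simp only [Function.comp_apply] at hA hA'
  have hA2 := (Nat.cast_le (α := ℝ)).2 hA
  have hA2' := (Nat.cast_le (α := ℝ)).2 hA'
  rw [Nat.cast_sum] at hA2 hA2'
  push_cast at hA2 hA2'
  refine (Finset.sum_le_sum fun i _ => hi i).trans ?_
  rw [Finset.sum_add_distrib, ← Finset.mul_sum, ← Finset.mul_sum]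
  linarith

end PairRun

/-! ### Differential privacy -/

lemma shiftBound_pi_laplace {b : ℝ} (hb : 0 < b) {p q : ℝ} (hpq : p.HolderConjugate q) (m : ℕ) :
    ShiftBound (Measure.pi fun _ : Fin m => laplace b) q
      fun Δ => ∑ u, p / (2 * b ^ 2) * Δ u ^ 2 :=
  fun Δ _ hg => (shiftBound_laplace hb hpq).pi hpq.symm.pos (fun _ => Δ) (fun _ _ _ _ => rfl)
    (fun _ => le_rfl) hg

lemma noiseAt_of_lt {N m : ℕ} (ω : Fin N → Fin m → ℝ) {i : ℕ} (h : i < N) :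
    noiseAt ω i = ω ⟨i, h⟩ := by
  funext u
  simp [noiseAt, h]

lemma lintegral_runDA_le {n m J N : ℕ} {k : ℕ} (sel : SelectionRule m) (C : Fin m → ℕ) (E : ℝ)
    {D D' : Database n m J} (hn : 0 < n) (hN : m * J * n ≤ N) (h : Neighboring D D') {b : ℝ}
    (hb : 0 < b) {p q : ℝ} (hpq : p.HolderConjugate q) (f : (Fin m → ℕ) → ENNReal) :
    ∫⁻ ω : Fin N → Fin m → ℝ, f (runDA k sel C E D (noiseAt ω))
        ∂(Measure.pi fun _ => Measure.pi fun _ => laplace b) ≤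
      ENNReal.ofReal (Real.exp (p / (2 * b ^ 2) * (8 * k * (Nat.log 2 N + 1)))) *
        (∫⁻ ω : Fin N → Fin m → ℝ, f (runDA k sel C E D' (noiseAt ω)) ^ q
          ∂(Measure.pi fun _ => Measure.pi fun _ => laplace b)) ^ (1 / q) := by
  obtain ⟨a, ha⟩ := h
  have hf : Measurable fun ω : Fin N → Fin m → ℝ => f (runDA k sel C E D' (noiseAt ω)) :=
    (Measurable.of_discrete (f := f)).comp (measurable_runDA k sel C E D')
  have key := (shiftBound_pi_laplace hb hpq m).pi (N := N) hpq.symm.pos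
    (fun ω i => noiseShift k sel C E D D' (noiseAt ω) i) ?_
    (B := p / (2 * b ^ 2) * (8 * k * (Nat.log 2 N + 1))) ?_ hf
  · refine le_trans (le_of_eq (lintegral_congr fun ω => ?_)) key
    rw [runDA_eq_run, runDA_eq_run, ← pairRun_snd k sel C E (noiseAt ω) hn ha (R := m * J) ?_ _
      le_rfl, ← (pairRun_eq k sel C E (noiseAt ω) ha _).1, pairRun_fst]
    intro i hi u
    rw [noiseAt_of_lt _ (hi.trans_le hN), noiseAt_of_lt _ (hi.trans_le hN)]
    rfl
  · intro i ω ω' hω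
    refine noiseShift_congr k sel C E _ _ (fun j hj => ?_) hn
    rw [noiseAt_of_lt _ (hj.trans i.2), noiseAt_of_lt _ (hj.trans i.2)]
    exact hω _ hj
  · intro ω
    rw [Finset.sum_congr rfl fun i _ => (Finset.mul_sum _ _ _).symm, ← Finset.mul_sum]
    have hp := hpq.pos
    refine mul_le_mul_of_nonneg_left ?_ (by positivity)
    rw [Fin.sum_univ_eq_sum_range
      (fun i => ∑ u, noiseShift k sel C E D D' (noiseAt ω) i u ^ 2) N]
    exact sum_sq_noiseShift_le k sel C E _ ha N

/-- The hypothesis on V says that exp(pV/2) ≤ exp(ε/q) δ^(1/p). Weighted AM-GM then applies to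
exp(ε)x and δ, and the weights, at most 1, are dropped. -/
lemma young_bound {ε δ p q V x : ℝ} (hδ : 0 < δ) (hpq : p.HolderConjugate q) (hx : 0 ≤ x)
    (hV : p ^ 2 * V / 2 ≤ ε * (p - 1) - Real.log (1 / δ)) :
    Real.exp (p / 2 * V) * x ^ (1 / q) ≤ Real.exp ε * x + δ := by
  have hp := hpq.pos
  have hq := hpq.symm.pos
  have h1 := Real.geom_mean_le_arith_mean2_weighted (w₁ := 1 / q) (w₂ := 1 / p)
    (p₁ := Real.exp ε * x) (p₂ := δ) (by positivity) (by positivity) (by positivity) hδ.le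
    (by have := hpq.inv_add_inv_eq_one; rw [one_div, one_div]; linarith)
  have hq1 : 1 / q ≤ 1 := by
    rw [div_le_one hq]; exact hpq.symm.lt.le
  have hp1 : 1 / p ≤ 1 := by
    rw [div_le_one hp]; exact hpq.lt.le
  have h2 : Real.exp (p / 2 * V) * x ^ (1 / q) ≤ (Real.exp ε * x) ^ (1 / q) * δ ^ (1 / p) := by
    rw [Real.mul_rpow (Real.exp_pos _).le hx, ← Real.exp_mul, Real.rpow_def_of_pos hδ, mul_right_comm,
      ← Real.exp_add]
    refine mul_le_mul_of_nonneg_right (Real.exp_le_exp.2 ?_) (Real.rpow_nonneg hx _)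
    have hqe : 1 / q = 1 - 1 / p := by
      have := hpq.inv_add_inv_eq_one
      rw [one_div, one_div]; linarith
    rw [one_div, Real.log_inv] at hV
    rw [hqe]
    have : p / 2 * V = (p ^ 2 * V / 2) / p := by field_simp
    rw [this, div_le_iff₀ hp]
    refine hV.trans (le_of_eq ?_)
    field_simp
    ring
  have h3 : 1 / q * (Real.exp ε * x) ≤ 1 * (Real.exp ε * x) :=
    mul_le_mul_of_nonneg_right hq1 (by positivity)
  have h4 : 1 / p * δ ≤ 1 * δ := mul_le_mul_of_nonneg_right hp1 hδ.le
  linarith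

lemma horizon_pos {n m J : ℕ} (hn : 0 < n) (hm : 0 < m) (hJ : 0 < J) : 0 < horizon n m J := by
  unfold horizon
  positivity

lemma mul_le_horizon {n m J : ℕ} (hn : 0 < n) : m * J * n ≤ horizon n m J := by
  unfold horizon
  calc m * J * n = n * (m * 1 * J) := by ring
    _ ≤ n * (m * n * J) := by gcongr; omega

/-- The noise scale of the counters. -/
lemma counterEps_eq {m k : ℕ} {ε δ : ℝ} (hm : 0 < m) :
    counterEps m (ε * √m / (2 * √k)) δ = ε / (32 * √(2 * k * Real.log (1 / δ))) := by
  have h1 : √(m : ℝ) ≠ 0 := (Real.sqrt_pos.2 (by exact_mod_cast hm)).ne'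
  unfold counterEps
  rw [Real.sqrt_mul (by positivity), Real.sqrt_mul (by positivity), Real.sqrt_mul (by positivity),
    Real.sqrt_mul (by positivity), div_div, show 2 * √(k : ℝ) * (16 * (√2 * √m * √(Real.log (1 / δ))))
      = 32 * (√2 * √k * √(Real.log (1 / δ))) * √m by ring, mul_div_mul_right _ _ h1]

lemma one_le_logb_horizon {N : ℕ} (hN : 1 < N) : 1 ≤ Real.logb 2 N := by
  rw [Real.le_logb_iff_rpow_le (by norm_num) (by positivity), Real.rpow_one]
  exact_mod_cast hN

lemma natLog_le_logb {N : ℕ} : (Nat.log 2 N : ℝ) ≤ Real.logb 2 N :=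
  Real.natLog_le_logb N 2

lemma half_le_log_inv {δ : ℝ} (hδ : 0 < δ) (hδ' : δ ≤ 1 / 2) : 1 / 2 ≤ Real.log (1 / δ) := by
  have h1 : Real.log 2 ≤ Real.log (1 / δ) := by
    refine Real.log_le_log (by norm_num) ?_
    rw [le_div_iff₀ hδ]
    linarith
  linarith [Real.log_two_gt_d9]

/-- Private deferred acceptance is differentially private, in the form for `[0, 1]`-valued functions
of the thresholds. -/
lemma lintegral_privateDA_le {n m J k : ℕ} {ε δ β : ℝ} (hn : 0 < n) (hm : 0 < m) (hJ : 0 < J)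
    (hk : 0 < k) (hε : 0 < ε) (hε' : ε ≤ 1) (hδ : 0 < δ) (hδ' : δ ≤ 1 / 2) (sel : SelectionRule m)
    (C : Fin m → ℕ) {D D' : Database n m J} (h : Neighboring D D')
    (f : (Fin m → ℕ) → ENNReal) (hf : ∀ t, f t ≤ 1) :
    ∫⁻ t, f t ∂(privateDA k sel C (ε * √m / (2 * √k)) δ β D) ≤
      ENNReal.ofReal (Real.exp ε) *
        ∫⁻ t, f t ∂(privateDA k sel C (ε * √m / (2 * √k)) δ β D') + ENNReal.ofReal δ := by
  set E := reserve n m J (ε * √m / (2 * √k)) δ β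
  have hmap : ∀ D : Database n m J, ∫⁻ t, f t ∂(privateDA k sel C (ε * √m / (2 * √k)) δ β D) =
      ∫⁻ ω, f (runDA k sel C E D (noiseAt ω))
        ∂(noiseLaw n m J (counterEps m (ε * √m / (2 * √k)) δ)) := fun D =>
    lintegral_map Measurable.of_discrete (measurable_runDA k sel C E D)
  rw [hmap, hmap]
  rcases (Nat.succ_le_of_lt (horizon_pos hn hm hJ)).lt_or_eq with hN | hN
  · set L := Real.logb 2 (horizon n m J) with hL
    have hL1 : 1 ≤ L := one_le_logb_horizon hN
    have hΛ := half_le_log_inv hδ hδ'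
    set Λ := Real.log (1 / δ) with hΛdef
    have hkR : (0 : ℝ) < k := by exact_mod_cast hk
    set ε' := counterEps m (ε * √m / (2 * √k)) δ with hε'def
    have hε'sq : ε' ^ 2 = ε ^ 2 / (2048 * k * Λ) := by
      rw [hε'def, counterEps_eq hm, div_pow, mul_pow, Real.sq_sqrt (by positivity)]
      ring
    have hε'pos : 0 < ε' := by
      rw [hε'def, counterEps_eq hm]
      have : 0 < √(2 * k * Real.log (1 / δ)) := Real.sqrt_pos.2 (by positivity)
      positivity
    set b := L / ε' with hb
    have hbpos : 0 < b := by positivity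
    -- With this p, ε(p - 1) = 2Λ, which leaves Λ for the cost p²V/2. Since ε ≤ 1 ≤ 2Λ, one has pε ≤
    -- 4Λ, so V ≤ ε²/(128Λ) is ample.
    set p : ℝ := 1 + 2 * Λ / ε with hp
    have hp1 : 1 < p := by
      have : 0 < 2 * Λ / ε := by positivity
      linarith
    have hpq := Real.HolderConjugate.conjExponent hp1
    set q := p.conjExponent
    have key := lintegral_runDA_le (k := k) sel C E hn (mul_le_horizon (m := m) (J := J) hn) h hbpos
      hpq f
    set I := ∫⁻ ω, f (runDA k sel C E D' (noiseAt ω)) ∂(noiseLaw n m J ε') with hI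
    have hI1 : I ≤ 1 := by
      calc I ≤ ∫⁻ _, 1 ∂(noiseLaw n m J ε') := lintegral_mono fun ω => hf _
        _ = 1 := by simp
    have hpow : ∫⁻ ω, f (runDA k sel C E D' (noiseAt ω)) ^ q ∂(noiseLaw n m J ε') ≤ I := by
      refine lintegral_mono fun ω => ?_
      simpa using ENNReal.rpow_le_rpow_of_exponent_ge (hf (runDA k sel C E D' (noiseAt ω)))
        hpq.symm.lt.le
    have hItop : I ≠ ⊤ := (hI1.trans_lt ENNReal.one_lt_top).ne
    set V : ℝ := 8 * k * (Nat.log 2 (horizon n m J) + 1) / b ^ 2 with hVdef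
    have hV : V ≤ ε ^ 2 / (128 * Λ) := by
      have h1 : (Nat.log 2 (horizon n m J) : ℝ) + 1 ≤ 2 * L ^ 2 := by
        have : (Nat.log 2 (horizon n m J) : ℝ) ≤ L := natLog_le_logb
        nlinarith
      rw [hVdef, hb, div_pow, hε'sq]
      rw [div_le_iff₀ (by positivity)]
      calc 8 * k * ((Nat.log 2 (horizon n m J) : ℝ) + 1) ≤ 8 * k * (2 * L ^ 2) := by gcongr
        _ = _ := by field_simp; norm_num
    have hVp : p ^ 2 * V / 2 ≤ ε * (p - 1) - Λ := by
      have h1 : p * ε = ε + 2 * Λ := by rw [hp]; field_simp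
      have h2 : ε * (p - 1) = 2 * Λ := by rw [hp]; field_simp; ring
      have h3 : p ^ 2 * V ≤ (ε + 2 * Λ) ^ 2 / (128 * Λ) := by
        rw [← h1]
        calc p ^ 2 * V ≤ p ^ 2 * (ε ^ 2 / (128 * Λ)) := by gcongr
          _ = _ := by ring
      have h4 : (ε + 2 * Λ) ^ 2 / (128 * Λ) ≤ Λ := by
        rw [div_le_iff₀ (by positivity)]
        nlinarith
      rw [h2]
      linarith
    refine key.trans ?_
    have hy := young_bound hδ hpq (x := I.toReal) ENNReal.toReal_nonneg hVp
    have hq := hpq.symm.pos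
    calc _ ≤ ENNReal.ofReal (Real.exp (p / 2 * V)) * I ^ (1 / q) := by
          refine mul_le_mul' (ENNReal.ofReal_le_ofReal (Real.exp_le_exp.2 (le_of_eq ?_))) ?_
          · rw [hVdef]; field_simp
          · exact ENNReal.rpow_le_rpow hpow (by positivity)
      _ = ENNReal.ofReal (Real.exp (p / 2 * V) * I.toReal ^ (1 / q)) := by
          rw [ENNReal.ofReal_mul (Real.exp_pos _).le,
            ← ENNReal.ofReal_rpow_of_nonneg ENNReal.toReal_nonneg (by positivity),
            ENNReal.ofReal_toReal hItop]
      _ ≤ ENNReal.ofReal (Real.exp ε * I.toReal + δ) := ENNReal.ofReal_le_ofReal hy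
      _ = _ := by
          rw [ENNReal.ofReal_add (by positivity) hδ.le, ENNReal.ofReal_mul (Real.exp_pos _).le,
            ENNReal.ofReal_toReal hItop]
  -- At horizon 1 the logarithm vanishes and the noise is degenerate. The single decision is then
  -- taken from empty counters and does not depend on the data.
  · have hmJ : m * J = 1 := by
      have h1 := mul_le_horizon (m := m) (J := J) hn
      have h2 : 0 < m * J := Nat.mul_pos hm hJ
      have h3 : m * J ≤ m * J * n := Nat.le_mul_of_pos_right _ hn
      omega
    have hrun : ∀ ω : Fin (horizon n m J) → Fin m → ℝ,
        runDA k sel C E D (noiseAt ω) = runDA k sel C E D' (noiseAt ω) := by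
      intro ω
      rw [runDA_eq_run, runDA_eq_run, hmJ, Core.run_succ, Core.run_succ]
      change (Core.step k sel D ((Core.init n m J).under C E (noiseAt ω)) (Core.init n m J)).1 =
        (Core.step k sel D' ((Core.init n m J).under C E (noiseAt ω)) (Core.init n m J)).1
      unfold Core.step
      split_ifs <;> rfl
    simp only [hrun]
    refine le_trans ?_ le_self_add
    refine le_mul_of_one_le_left zero_le ?_
    rw [← ENNReal.ofReal_one]
    exact ENNReal.ofReal_le_ofReal (Real.one_le_exp hε.le)

lemma isDifferentiallyPrivate_privateDA {n m J k : ℕ} {ε δ β : ℝ} (hn : 0 < n) (hm : 0 < m)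
    (hJ : 0 < J) (hk : 0 < k) (hε : 0 < ε) (hε' : ε ≤ 1) (hδ : 0 < δ) (hδ' : δ ≤ 1 / 2)
    (sel : SelectionRule m) (C : Fin m → ℕ) :
    IsDifferentiallyPrivate
      (fun D : Database n m J => privateDA k sel C (ε * √m / (2 * √k)) δ β D) ε δ := by
  intro D D' h S
  have := lintegral_privateDA_le (β := β) hn hm hJ hk hε hε' hδ hδ' sel C h (S.indicator 1)
    fun t => Set.indicator_le_self' (fun _ _ => zero_le_one) t |>.trans (by simp)
  simpa [lintegral_indicator_one (MeasurableSet.of_discrete (s := S))] using this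

/-! ### Truthfulness -/

/-- A false list can only win a school whose cutoff the unchanged score reaches. It is either truly
listed, hence available to the true choice, or unlisted, hence worse than any available outcome. -/
lemma le_of_misreport {n m J : ℕ} (D : Database n m J) (a : Fin n)
    (p : {l : List (Fin m) // l.Nodup}) {v : Option (Fin m) → ℝ}
    (hv : ConsistentUtility (D a).pref v) (t : Fin m → ℕ) :
    v (inducedMatching (misreport D a p) t a) ≤ v (inducedMatching D t a) := by
  simp only [inducedMatching, misreport, Function.update_self]
  set x := choice { pref := p, score := (D a).score } t with hx
  rcases lt_trichotomy (prefRank (D a).pref (choice (D a) t)) (prefRank (D a).pref x) with h | h | h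
  · exact hv.2 _ _ h
  · by_cases hav : x ∈ Available (D a) t
    · rw [prefRank_inj (choice_mem_available _ _) hav h]
    · exfalso
      refine hav fun u hu => ⟨?_, ?_⟩
      · by_contra hmem
        rw [hu] at h
        have h1 := prefRank_le_length (choice_mem_available (D a) t)
        simp [prefRank, hmem] at h
        simp only [prefRank] at h1
        omega
      · exact score_le_of_choice (s := { pref := p, score := (D a).score }) (hx ▸ hu)
  · exfalso
    by_cases hav : x ∈ Available (D a) t
    · exact absurd (prefRank_choice_le hav) (not_le.2 h)
    · refine hav fun u hu => ⟨?_, ?_⟩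
      · by_contra hmem
        rw [hu] at h
        have h1 := prefRank_le_length (choice_mem_available (D a) t)
        have h2 : prefRank (D a).pref (some u) = (D a).pref.1.length + 1 := by
          simp [prefRank, hmem]
        omega
      · exact score_le_of_choice (s := { pref := p, score := (D a).score }) (hx ▸ hu)

lemma isApproxTruthful_of_lintegral_le {n m J : ℕ} {ε δ : ℝ} (hδ : 0 < δ) (hε : 0 < ε)
    {M : Database n m J → Measure (Fin m → ℕ)} (hM : ∀ D, IsProbabilityMeasure (M D))
    (h : ∀ D D', Neighboring D D' → ∀ f : (Fin m → ℕ) → ENNReal, (∀ t, f t ≤ 1) →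
      ∫⁻ t, f t ∂(M D) ≤ ENNReal.ofReal (Real.exp ε) * ∫⁻ t, f t ∂(M D') + ENNReal.ofReal δ) :
    IsApproxTruthful M (ε + δ) := by
  intro D a v hv p
  set w : (Fin m → ℕ) → ℝ := fun t => v (inducedMatching D t a) with hw
  have hw0 : ∀ t, 0 ≤ w t := fun t => (hv.1 _).1
  have hw1 : ∀ t, w t ≤ 1 := fun t => (hv.1 _).2
  have hint : ∀ (D' : Database n m J) (g : (Fin m → ℕ) → ℝ), (∀ t, 0 ≤ g t) → (∀ t, g t ≤ 1) →
      Integrable g (M D') := fun D' g h0 h1 => by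
    have := hM D'
    exact Integrable.of_bound Measurable.of_discrete.aestronglyMeasurable 1
      (Filter.Eventually.of_forall fun t => by rw [Real.norm_of_nonneg (h0 t)]; exact h1 t)
  have hD' := hM (misreport D a p)
  have h1 : ∫ t, v (inducedMatching (misreport D a p) t a) ∂(M (misreport D a p)) ≤
      ∫ t, w t ∂(M (misreport D a p)) :=
    integral_mono (hint _ _ (fun t => (hv.1 _).1) fun t => (hv.1 _).2) (hint _ _ hw0 hw1)
      fun t => le_of_misreport D a p hv t
  have hx0 : 0 ≤ ∫ t, w t ∂(M D) := integral_nonneg hw0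
  have hx1 : ∫ t, w t ∂(M (misreport D a p)) ≤ 1 := by
    refine (integral_mono (hint _ _ hw0 hw1) (integrable_const 1) hw1).trans_eq ?_
    simp
  have hdp := h (misreport D a p) D ⟨a, fun b hb => by simp [misreport, hb]⟩
    (fun t => ENNReal.ofReal (w t)) fun t => by simpa using hw1 t
  rw [← ofReal_integral_eq_lintegral_ofReal (hint _ _ hw0 hw1) (Filter.Eventually.of_forall hw0),
    ← ofReal_integral_eq_lintegral_ofReal (hint _ _ hw0 hw1) (Filter.Eventually.of_forall hw0),
    ← ENNReal.ofReal_mul (Real.exp_pos _).le, ← ENNReal.ofReal_add (by positivity) hδ.le,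
    ENNReal.ofReal_le_ofReal_iff (by positivity)] at hdp
  set X := ∫ t, w t ∂(M D)
  set X' := ∫ t, w t ∂(M (misreport D a p))
  have hfinal : X' - (ε + δ) ≤ X := by
    by_cases hneg : X' ≤ δ
    · linarith
    · have hexp : (X' - δ) * Real.exp (-ε) ≤ X := by
        rw [Real.exp_neg, ← div_eq_mul_inv, div_le_iff₀ (Real.exp_pos _)]
        linarith
      -- Since X' - δ ≤ 1, multiplying it by 1 - ε loses at most ε.
      have h2 : 1 - ε ≤ Real.exp (-ε) := by linarith [Real.add_one_le_exp (-ε)]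
      have h3 := mul_le_mul_of_nonneg_left h2 (show 0 ≤ X' - δ by linarith)
      nlinarith
  linarith

/-! ### Utility of accurate runs -/

/-- A student who has accepted few proposals and is matched to an available outcome moves to her
choice, however low the thresholds get. -/
lemma studentStep_eq_choice {m J k : ℕ} {s : Student m J} {t t' : Fin m → ℕ}
    {x : Option (Fin m) × ℕ} (hk : s.pref.1.length ≤ k) (ht : t' ≤ t)
    (hx : x.1 ∈ Available s t) (hr : x.2 + prefRank s.pref x.1 ≤ s.pref.1.length) :
    (studentStep k s t' x).1 = choice s t' ∧
      (studentStep k s t' x).2 + prefRank s.pref (choice s t') ≤ s.pref.1.length := by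
  have hx' := Available.anti ht hx
  have hle := prefRank_choice_le hx'
  have hinj := fun h => prefRank_inj (choice_mem_available s t') hx' h
  unfold studentStep
  split_ifs with h
  · refine ⟨rfl, ?_⟩
    have : prefRank s.pref (choice s t') ≠ prefRank s.pref x.1 := fun he => h.2 (hinj he).symm
    simp only
    omega
  · have he : x.1 = choice s t' := by
      by_contra hne
      -- A student at the limit has rank 0 by `hr`, so no better outcome exists.
      have : ¬ x.2 < k := fun hlt => h ⟨hlt, hne⟩
      exact hne (hinj (by omega)).symm
    rw [← he]
    exact ⟨rfl, hr⟩

section Accurate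

variable {n m J k : ℕ} {sel : SelectionRule m} {C : Fin m → ℕ} {E : ℝ} {D : Database n m J}
  {y : ℕ → Fin m → ℝ}

/-- The invariants of a run with accurate counters. -/
structure Core.Good (C : Fin m → ℕ) (D : Database n m J) (x : Core n m) : Prop where
  -- Initially everyone is unmatched, although a student of score J could already pass a cutoff; the
  -- matching agrees with the induced one only from the first pass on.
  init_or : x = Core.init n m J ∨ 0 < x.2.2 ∧ ∀ a, (x.2.1 a).1 = choice (D a) x.1
  available : ∀ a, (x.2.1 a).1 ∈ Available (D a) x.1
  accepted : ∀ a, (x.2.1 a).2 + prefRank (D a).pref (x.2.1 a).1 ≤ (D a).pref.1.length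
  card_le : ∀ u, (enrolled (inducedMatching D x.1) u).card ≤ C u
  ge : ∀ r, Clearing C D r → r ≤ x.1
  sum : ∑ u, x.1 u + x.2.2 = m * J

lemma Core.Good.load {x : Core n m} (h : x.Good C D) (hp : 0 < x.2.2) (u : Fin m) :
    x.load u = (enrolled (inducedMatching D x.1) u).card := by
  rcases h.init_or with rfl | ⟨-, h'⟩
  · exact absurd hp (lt_irrefl 0)
  · unfold Core.load
    congr 2
    exact funext h'

lemma Core.good_init (hC : ∀ u, 2 ≤ C u) (hD : UniqueScores D) :
    (Core.init n m J).Good C D where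
  init_or := Or.inl rfl
  available a u hu := by simp [Core.init] at hu
  accepted a := by simp [Core.init, prefRank]
  card_le u := (card_enrolled_top_le_one hD u).trans (by have := hC u; omega)
  ge r hr u := hr.le_top u
  sum := by simp [Core.init]

lemma Core.Good.step (hC : ∀ u, 2 ≤ C u) (hD : UniqueScores D)
    (hk : ∀ a, (D a).pref.1.length ≤ k) {x : Core n m} (h : x.Good C D)
    (hacc : ∀ u, |releasedNoise (fun i => y i u) (x.2.2 * n)| ≤ E) :
    (Core.step k sel D (x.under C E y) x).Good C D := by
  rcases Finset.eq_empty_or_nonempty (x.under C E y) with hU | hU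
  · rw [hU, Core.step_empty]
    exact h
  rw [Core.step_of_nonempty hU]
  set u := sel.pick x.1 (x.under C E y)
  have hu : u ∈ x.under C E y := sel.pick_mem _ _ hU
  simp only [Core.under, Finset.mem_filter, Finset.mem_univ, true_and] at hu
  obtain ⟨hu1, hu2⟩ := hu
  have hlt : (enrolled (inducedMatching D x.1) u).card < C u := by
    -- Before the first pass the counters say nothing about the induced matching; there distinct
    -- scores allow one student per school, and C u ≥ 2 suffices.
    rcases h.init_or with hi | ⟨hp, -⟩
    · have h1 := card_enrolled_top_le_one hD u
      have h2 := hC u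
      rw [hi]
      exact h1.trans_lt h2
    · rw [h.load hp] at hu1
      have := (abs_le.1 (hacc u)).1
      exact_mod_cast (show ((enrolled (inducedMatching D x.1) u).card : ℝ) < C u by linarith)
  have hst := fun a => studentStep_eq_choice (hk a) (lower_le x.1 u) (h.available a) (h.accepted a)
  refine ⟨Or.inr ⟨Nat.succ_pos _, fun a => (hst a).1⟩, fun a => ?_, fun a => ?_, fun v => ?_,
    fun r hr => hr.le_lower (h.ge r hr) hlt, ?_⟩
  · simp only [(hst a).1]
    exact choice_mem_available _ _
  · simp only [(hst a).1]
    exact (hst a).2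
  · refine (card_enrolled_lower_le hD x.1 u v).trans ?_
    split_ifs with hv
    · rw [hv]
      exact hlt
    · exact h.card_le v
  · have hsum := h.sum
    have herase : ∑ v ∈ Finset.univ.erase u, lower x.1 u v = ∑ v ∈ Finset.univ.erase u, x.1 v :=
      Finset.sum_congr rfl fun v hv => by
        rw [lower, Function.update_of_ne (Finset.ne_of_mem_erase hv)]
    have hself : lower x.1 u u = x.1 u - 1 := by simp [lower]
    rw [← Finset.add_sum_erase _ _ (Finset.mem_univ u)] at hsum ⊢
    simp only [herase, hself]
    omega

/-- If the counters are accurate up to `E`, the final thresholds are good. -/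
lemma runDA_good {α : ℝ} (hα : α ≤ 1) (hC : ∀ u, 2 ≤ C u)
    (hE : ∀ u, 2 * E ≤ α * C u) (hD : UniqueScores D) (hk : ∀ a, (D a).pref.1.length ≤ k)
    (hacc : ∀ r < m * J, ∀ u, |releasedNoise (fun i => y i u) (r * n)| ≤ E) :
    IsApproxStable α C D (inducedMatching D (runDA k sel C E D y)) ∧
      SchoolDominant C D (inducedMatching D (runDA k sel C E D y)) := by
  have hpass := fun r => pairRun_pass k sel C E D D y r
  simp only [pairRun_fst] at hpass
  have hgood : ∀ r ≤ m * J, (Core.run k sel C E D y r).Good C D := by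
    intro r hr
    induction r with
    | zero => exact Core.good_init hC hD
    | succ r ih =>
      rw [Core.run_succ]
      exact (ih (by omega)).step hC hD hk fun u => hacc _ ((hpass r).2.1.trans_lt hr) u
  have hg := hgood _ le_rfl
  rw [runDA_eq_run]
  set x := Core.run k sel C E D y (m * J) with hx
  -- Each pass lowers the total of the thresholds by one, so using up all m * J passes brings them
  -- all to 0.
  have hend : x.1 = 0 ∨ x.2.2 < m * J ∧ x.under C E y = ∅ := by
    rcases (hpass (m * J)).2.1.lt_or_eq with h | h
    · exact Or.inr ⟨h, (hpass (m * J)).1.resolve_left h.ne⟩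
    · left
      have h : x.2.2 = m * J := h
      have h1 := hg.sum
      have h0 : ∑ u, x.1 u = 0 := by omega
      funext u
      exact Finset.sum_eq_zero_iff.1 h0 u (Finset.mem_univ u)
  refine ⟨isApproxStable_inducedMatching hg.card_le fun u hu => ?_,
    schoolDominant_of_le (fun u => by have := hC u; omega) hD hg.ge⟩
  rcases hend with h | ⟨hlt, hU⟩
  · rw [h] at hu
    exact absurd hu (lt_irrefl 0)
  have hnot : ∀ v, 0 < x.1 v →
      (C v : ℝ) - E ≤ x.load v + releasedNoise (fun i => y i v) (x.2.2 * n) := by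
    intro v hv
    by_contra hlt
    have : v ∈ x.under C E y := by
      simp only [Core.under, Finset.mem_filter, Finset.mem_univ, true_and]
      exact ⟨not_le.1 hlt, hv⟩
    rw [hU] at this
    simp at this
  -- The loop cannot stop at once with a positive threshold: empty counters show 0 without noise,
  -- and E ≤ C u / 2 < C u.
  have hp : 0 < x.2.2 := by
    by_contra h0
    rcases hg.init_or with hi | ⟨h, -⟩
    · have h1 := hnot u hu
      have h2 : (2 : ℝ) ≤ C u := by exact_mod_cast hC u
      have h3 : x.load u = 0 := by
        rw [hi]
        simp [Core.load, Core.init, enrolled]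
      have h4 : x.2.2 = 0 := by omega
      rw [h3, h4] at h1
      simp [releasedNoise] at h1
      have := hE u
      nlinarith
    · exact h0 h
  have h1 := hnot u hu
  rw [hg.load hp] at h1
  have h2 := (abs_le.1 (hacc _ hlt u)).2
  have h3 := hE u
  linarith

end Accurate

/-! ### Accuracy of the counters -/

/-- The times whose noise is released at time `t`. -/
def releasedTimes (t : ℕ) : Finset ℕ :=
  ((Finset.range t.size).filter fun i => t.testBit i = true).image fun i => clearBits t i - 1

lemma releasedNoise_eq_sum (y : ℕ → ℝ) (t : ℕ) :
    releasedNoise y t = ∑ s ∈ releasedTimes t, y s := by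
  unfold releasedNoise releasedTimes
  rw [Finset.sum_image]
  intro i hi j hj h
  have h1 := (Finset.mem_filter.1 hi).2
  have h2 := (Finset.mem_filter.1 hj).2
  have h3 := clearBits_pos h1
  have h4 := clearBits_pos h2
  rw [← padicValNat_clearBits h1, ← padicValNat_clearBits h2]
  congr 1
  simp only at h
  omega

lemma card_releasedTimes_le {t N : ℕ} (ht : t ≤ N) :
    (releasedTimes t).card ≤ Nat.log 2 N + 1 := by
  refine Finset.card_image_le.trans ((Finset.card_filter_le _ _).trans ?_)
  rw [Finset.card_range, Nat.size_le]
  exact ht.trans_lt (Nat.lt_pow_succ_log_self (by norm_num) N)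

lemma lt_of_mem_releasedTimes {s t : ℕ} (h : s ∈ releasedTimes t) : s < t := by
  obtain ⟨i, hi, rfl⟩ := Finset.mem_image.1 h
  have := clearBits_pos (Finset.mem_filter.1 hi).2
  have := clearBits_le t i
  omega

/-- At most log₂ N + 1 independent noises are released, each with exponential moment 1/(1 - l²) = 2.
-/
lemma lintegral_exp_releasedNoise_le {m N : ℕ} {b l : ℝ} (hb : 0 < b) (hl : l ^ 2 = 1 / 2)
    {t : ℕ} (ht : t ≤ N) (u : Fin m) :
    ∫⁻ ω : Fin N → Fin m → ℝ,
        ENNReal.ofReal (Real.exp (l / b * releasedNoise (fun i => noiseAt ω i u) t))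
        ∂(Measure.pi fun _ => Measure.pi fun _ => laplace b) ≤ 2 ^ (Nat.log 2 N + 1) := by
  classical
  have hl1 : |l| < 1 := by
    rw [← sq_lt_one_iff_abs_lt_one, hl]
    norm_num
  let f : Fin N → (Fin m → ℝ) → ENNReal := fun i z =>
    if (i : ℕ) ∈ releasedTimes t then ENNReal.ofReal (Real.exp (l / b * z u)) else 1
  have hf : ∀ i, Measurable (f i) := by
    intro i
    by_cases h : (i : ℕ) ∈ releasedTimes t
    · simp only [f, h, if_true]
      fun_prop
    · simp only [f, h, if_false]
      fun_prop
  have hprod : ∀ ω : Fin N → Fin m → ℝ,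
      ENNReal.ofReal (Real.exp (l / b * releasedNoise (fun i => noiseAt ω i u) t)) =
        ∏ i, f i (ω i) := by
    intro ω
    have h1 : ∏ i, f i (ω i) = ∏ i ∈ Finset.range N, if i ∈ releasedTimes t then
        ENNReal.ofReal (Real.exp (l / b * noiseAt ω i u)) else 1 := by
      rw [← Fin.prod_univ_eq_prod_range (fun i => if i ∈ releasedTimes t then
        ENNReal.ofReal (Real.exp (l / b * noiseAt ω i u)) else 1) N]
      refine Finset.prod_congr rfl fun i _ => ?_
      simp only [f, noiseAt_of_lt ω i.2]
    have h2 : (Finset.range N).filter (fun i => i ∈ releasedTimes t) = releasedTimes t := by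
      ext i
      simp only [Finset.mem_filter, Finset.mem_range, and_iff_right_iff_imp]
      exact fun h => (lt_of_mem_releasedTimes h).trans_le ht
    rw [h1, ← Finset.prod_filter, h2, ← ENNReal.ofReal_prod_of_nonneg fun _ _ => (Real.exp_pos _).le,
      ← Real.exp_sum, ← Finset.mul_sum, releasedNoise_eq_sum]
  rw [lintegral_congr hprod]
  refine (lintegral_pi_prod_le _ f hf).trans ?_
  have hint : ∀ i, ∫⁻ z, f i z ∂(Measure.pi fun _ : Fin m => laplace b) =
      if (i : ℕ) ∈ releasedTimes t then 2 else 1 := by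
    intro i
    by_cases h : (i : ℕ) ∈ releasedTimes t
    · simp only [f, h, if_true]
      rw [(measurePreserving_eval (fun _ : Fin m => laplace b) u).lintegral_comp
        (f := fun x => ENNReal.ofReal (Real.exp (l / b * x))) (by fun_prop),
        lintegral_exp_laplace hb hl1, hl]
      norm_num
    · simp [f, h]
  rw [Finset.prod_congr rfl fun i _ => hint i,
    Fin.prod_univ_eq_prod_range (fun i => if i ∈ releasedTimes t then (2 : ENNReal) else 1) N,
    ← Finset.prod_filter, Finset.prod_const]
  refine pow_le_pow_right₀ (by norm_num) ((Finset.card_le_card ?_).trans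
    (card_releasedTimes_le ht))
  intro i hi
  exact (Finset.mem_filter.1 hi).2

lemma measure_releasedNoise_gt_le {m N : ℕ} {b E : ℝ} (hb : 0 < b) {t : ℕ} (ht : t ≤ N)
    (u : Fin m) :
    (Measure.pi fun _ : Fin N => Measure.pi fun _ : Fin m => laplace b)
        {ω | ¬ |releasedNoise (fun i => noiseAt ω i u) t| ≤ E} ≤
      ENNReal.ofReal (2 * 2 ^ (Nat.log 2 N + 1) * Real.exp (-(E / (√2 * b)))) := by
  set μ := Measure.pi fun _ : Fin N => Measure.pi fun _ : Fin m => laplace b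
  have hR : Measurable fun ω : Fin N → Fin m → ℝ => releasedNoise (fun i => noiseAt ω i u) t :=
    measurable_releasedNoise (fun i => measurable_noiseAt i u) t
  have hs2 : (0 : ℝ) < √2 := by positivity
  have tail : ∀ l : ℝ, l ^ 2 = 1 / 2 →
      μ {ω | E / (√2 * b) ≤ l / b * releasedNoise (fun i => noiseAt ω i u) t} ≤
        ENNReal.ofReal (2 ^ (Nat.log 2 N + 1) * Real.exp (-(E / (√2 * b)))) := by
    intro l hl
    have hm := mul_meas_ge_le_lintegral (μ := μ) (f := fun ω => ENNReal.ofReal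
      (Real.exp (l / b * releasedNoise (fun i => noiseAt ω i u) t))) (by fun_prop)
      (ENNReal.ofReal (Real.exp (E / (√2 * b))))
    have hm := hm.trans (lintegral_exp_releasedNoise_le hb hl ht u)
    have hset : {ω : Fin N → Fin m → ℝ | ENNReal.ofReal (Real.exp (E / (√2 * b))) ≤ ENNReal.ofReal
        (Real.exp (l / b * releasedNoise (fun i => noiseAt ω i u) t))} =
        {ω | E / (√2 * b) ≤ l / b * releasedNoise (fun i => noiseAt ω i u) t} := by
      ext ω
      simp [ENNReal.ofReal_le_ofReal_iff (Real.exp_pos _).le, Real.exp_le_exp]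
    rw [hset] at hm
    have h2 : (2 : ENNReal) ^ (Nat.log 2 N + 1) = ENNReal.ofReal (2 ^ (Nat.log 2 N + 1)) := by
      rw [ENNReal.ofReal_pow (by norm_num)]
      norm_num
    rw [h2] at hm
    have h3 : Real.exp (-(E / (√2 * b))) * Real.exp (E / (√2 * b)) = 1 := by
      rw [← Real.exp_add]; simp
    calc μ _ = ENNReal.ofReal (Real.exp (-(E / (√2 * b)))) *
          (ENNReal.ofReal (Real.exp (E / (√2 * b))) * μ _) := by
          rw [← mul_assoc, ← ENNReal.ofReal_mul (Real.exp_pos _).le, h3, ENNReal.ofReal_one, one_mul]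
      _ ≤ ENNReal.ofReal (Real.exp (-(E / (√2 * b)))) *
          ENNReal.ofReal (2 ^ (Nat.log 2 N + 1)) := by gcongr
      _ = _ := by rw [← ENNReal.ofReal_mul (Real.exp_pos _).le, mul_comm]
  have hsq : (√2 : ℝ) ^ 2 = 2 := Real.sq_sqrt (by norm_num)
  have h1 := tail (1 / √2) (by rw [div_pow, hsq]; norm_num)
  have h2 := tail (-(1 / √2)) (by rw [neg_sq, div_pow, hsq]; norm_num)
  calc μ _ ≤ μ ({ω | E / (√2 * b) ≤ 1 / √2 / b * releasedNoise (fun i => noiseAt ω i u) t} ∪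
        {ω | E / (√2 * b) ≤ -(1 / √2) / b * releasedNoise (fun i => noiseAt ω i u) t}) := by
        refine measure_mono fun ω hω => ?_
        have hω : E < |releasedNoise (fun i => noiseAt ω i u) t| := not_le.1 hω
        rcases lt_abs.1 hω with h | h
        · left
          change E / (√2 * b) ≤ 1 / √2 / b * releasedNoise (fun i => noiseAt ω i u) t
          rw [div_div, one_div_mul_eq_div]
          gcongr
        · right
          change E / (√2 * b) ≤ -(1 / √2) / b * releasedNoise (fun i => noiseAt ω i u) t
          rw [neg_div, neg_mul, ← mul_neg, div_div, one_div_mul_eq_div]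
          gcongr
    _ ≤ _ := (measure_union_le _ _).trans (add_le_add h1 h2)
    _ = _ := by
        rw [← ENNReal.ofReal_add (by positivity) (by positivity)]
        congr 1
        ring

/-- With q = log(2m/β) and N = 2^L, the prefactors amount to β exp(q + (2L + 1) log 2). As log 2 ≤ q
and L ≥ 1, the exponent is at most 4qL ≤ 4q√L³. -/
lemma failure_bound {m N R : ℕ} {β : ℝ} (hm : 0 < m) (hβ : 0 < β) (hβ' : β < 1) (hR : R ≤ N)
    (hN : 1 < N) :
    (R : ℝ) * (m * (2 * 2 ^ (Nat.log 2 N + 1) *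
      Real.exp (-(4 * Real.log (2 * m / β) * √(Real.logb 2 N) ^ 3)))) ≤ β := by
  set L := Real.logb 2 N with hL
  have hL1 : 1 ≤ L := one_le_logb_horizon hN
  set q := Real.log (2 * m / β) with hq
  have hm1 : (1 : ℝ) ≤ m := by exact_mod_cast hm
  have hN0 : (0 : ℝ) < N := by exact_mod_cast (by omega : 0 < N)
  have hq2 : Real.log 2 ≤ q := by
    refine Real.log_le_log (by norm_num) ?_
    rw [le_div_iff₀ hβ]
    nlinarith
  have hlog2 : 0 < Real.log 2 := Real.log_pos (by norm_num)
  have he : 2 * (m : ℝ) = β * Real.exp q := by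
    rw [hq, Real.exp_log (by positivity)]
    field_simp
  have hLN : L * Real.log 2 = Real.log N := by
    rw [hL, Real.logb]
    field_simp
  have hRe : (R : ℝ) ≤ Real.exp (L * Real.log 2) := by
    rw [hLN, Real.exp_log hN0]
    exact_mod_cast hR
  have hpow : (2 : ℝ) ^ (Nat.log 2 N + 1) ≤ Real.exp ((L + 1) * Real.log 2) := by
    rw [← Real.rpow_natCast, Real.rpow_def_of_pos (by norm_num), Real.exp_le_exp, mul_comm]
    have : (Nat.log 2 N : ℝ) ≤ L := natLog_le_logb
    push_cast
    gcongr
  have hs : L ≤ √L ^ 3 := by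
    have h1 : √L ^ 2 = L := Real.sq_sqrt (by linarith)
    have h2 : 1 ≤ √L := Real.one_le_sqrt.2 hL1
    calc L = √L ^ 2 := h1.symm
      _ ≤ √L ^ 3 := pow_le_pow_right₀ h2 (by norm_num)
  calc (R : ℝ) * (m * (2 * 2 ^ (Nat.log 2 N + 1) * Real.exp (-(4 * q * √L ^ 3))))
      = (R : ℝ) * (2 * m) * 2 ^ (Nat.log 2 N + 1) * Real.exp (-(4 * q * √L ^ 3)) := by ring
    _ ≤ Real.exp (L * Real.log 2) * (β * Real.exp q) * Real.exp ((L + 1) * Real.log 2) *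
        Real.exp (-(4 * q * √L ^ 3)) := by rw [he]; gcongr
    _ = β * Real.exp (L * Real.log 2 + q + (L + 1) * Real.log 2 + -(4 * q * √L ^ 3)) := by
        rw [Real.exp_add, Real.exp_add, Real.exp_add]
        ring
    _ ≤ β * 1 := by
        gcongr
        rw [Real.exp_le_one_iff]
        have h1 : q * L ≤ q * √L ^ 3 := by gcongr; linarith
        have h2 : Real.log 2 * L ≤ q * L := by gcongr
        have h3 : q * 1 ≤ q * L := by gcongr; linarith
        have h4 : Real.log 2 * 1 ≤ Real.log 2 * L := by gcongr
        nlinarith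
    _ = β := mul_one β

lemma reserve_nonneg {n m J k : ℕ} {ε δ β : ℝ} (hm : 0 < m) (hε : 0 < ε) (hβ : 0 < β)
    (hβ' : β < 1) : 0 ≤ reserve n m J (ε * √m / (2 * √k)) δ β := by
  have hm1 : (1 : ℝ) ≤ m := by exact_mod_cast hm
  have : 0 ≤ Real.log (2 * m / β) := by
    refine Real.log_nonneg ?_
    rw [le_div_iff₀ hβ]
    nlinarith
  unfold reserve
  positivity

lemma reserve_eq {n m J k : ℕ} {ε δ β : ℝ} (hm : 0 < m) :
    reserve n m J (ε * √m / (2 * √k)) δ β =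
      256 * √k / ε * √(Real.log (1 / δ)) * Real.log (2 * m / β) *
        √(Real.logb 2 (horizon n m J)) ^ 5 := by
  have h1 : √(m : ℝ) ≠ 0 := (Real.sqrt_pos.2 (by exact_mod_cast hm)).ne'
  unfold reserve
  rw [Real.sqrt_mul (by positivity)]
  congr 2
  rw [div_div_eq_mul_div]
  field_simp
  ring

lemma measure_inaccurate_le {n m J k : ℕ} {ε δ β : ℝ} (hn : 0 < n) (hm : 0 < m) (hJ : 0 < J)
    (hk : 0 < k) (hε : 0 < ε) (hδ : 0 < δ) (hδ' : δ ≤ 1 / 2) (hβ : 0 < β) (hβ' : β < 1) :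
    noiseLaw n m J (counterEps m (ε * √m / (2 * √k)) δ)
      {ω | ¬ ∀ r < m * J, ∀ u, |releasedNoise (fun i => noiseAt ω i u) (r * n)| ≤
        reserve n m J (ε * √m / (2 * √k)) δ β} ≤ ENNReal.ofReal β := by
  set E := reserve n m J (ε * √m / (2 * √k)) δ β with hE
  have hE0 : 0 ≤ E := reserve_nonneg hm hε hβ hβ'
  rcases (Nat.succ_le_of_lt (horizon_pos hn hm hJ)).lt_or_eq with hN | hN
  · set L := Real.logb 2 (horizon n m J) with hL
    have hL1 : 1 ≤ L := one_le_logb_horizon hN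
    have hΛ := half_le_log_inv hδ hδ'
    have hkR : (0 : ℝ) < k := by exact_mod_cast hk
    have hkR' : 0 < √(k : ℝ) := Real.sqrt_pos.2 hkR
    have hΛ' : 0 < √(Real.log (1 / δ)) := Real.sqrt_pos.2 (by linarith)
    set ε' := counterEps m (ε * √m / (2 * √k)) δ with hε'def
    have hε'eq : ε' = ε / (32 * (√2 * √k * √(Real.log (1 / δ)))) := by
      rw [hε'def, counterEps_eq hm, Real.sqrt_mul (by positivity), Real.sqrt_mul (by positivity)]
    have hε'pos : 0 < ε' := by
      rw [hε'eq]
      positivity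
    have hb : 0 < L / ε' := by positivity
    have hexp : E / (√2 * (L / ε')) = 4 * Real.log (2 * m / β) * √L ^ 3 := by
      have hsL : √L ^ 2 = L := Real.sq_sqrt (by linarith)
      have hs2 : (√2 : ℝ) ^ 2 = 2 := Real.sq_sqrt (by norm_num)
      have hsLpos : 0 < √L := Real.sqrt_pos.2 (by linarith)
      rw [hE, reserve_eq hm, hε'eq, ← hL]
      nth_rewrite 2 [← hsL]
      field_simp
      rw [hs2]
      ring
    have hsub : {ω : Fin (horizon n m J) → Fin m → ℝ |
        ¬ ∀ r < m * J, ∀ u, |releasedNoise (fun i => noiseAt ω i u) (r * n)| ≤ E} ⊆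
        ⋃ r ∈ Finset.range (m * J), ⋃ u ∈ (Finset.univ : Finset (Fin m)),
          {ω | ¬ |releasedNoise (fun i => noiseAt ω i u) (r * n)| ≤ E} := by
      intro ω hω
      change ¬ ∀ r < m * J, ∀ u, |releasedNoise (fun i => noiseAt ω i u) (r * n)| ≤ E at hω
      push Not at hω
      obtain ⟨r, hr, u, h⟩ := hω
      simp only [Set.mem_iUnion]
      exact ⟨r, Finset.mem_range.2 hr, u, Finset.mem_univ u, not_le.2 h⟩
    have hRN : m * J ≤ horizon n m J :=
      (Nat.le_mul_of_pos_right _ hn).trans (mul_le_horizon hn)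
    refine (measure_mono hsub).trans ((measure_biUnion_finset_le _ _).trans ?_)
    have hbound : ∀ r ∈ Finset.range (m * J),
        noiseLaw n m J ε' (⋃ u ∈ (Finset.univ : Finset (Fin m)),
          {ω | ¬ |releasedNoise (fun i => noiseAt ω i u) (r * n)| ≤ E}) ≤
        ENNReal.ofReal (m * (2 * 2 ^ (Nat.log 2 (horizon n m J) + 1) *
          Real.exp (-(4 * Real.log (2 * m / β) * √L ^ 3)))) := by
      intro r hr
      refine (measure_biUnion_finset_le _ _).trans ?_
      refine (Finset.sum_le_card_nsmul _ _ _ fun u _ => measure_releasedNoise_gt_le hb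
        ((Nat.mul_le_mul_right n (Finset.mem_range.1 hr).le).trans (mul_le_horizon hn)) u).trans ?_
      rw [hexp, Finset.card_univ, Fintype.card_fin, nsmul_eq_mul, ENNReal.ofReal_mul (by positivity)
        (p := (m : ℝ)), ENNReal.ofReal_natCast]
    refine (Finset.sum_le_card_nsmul _ _ _ hbound).trans ?_
    rw [Finset.card_range, nsmul_eq_mul, ← ENNReal.ofReal_natCast,
      ← ENNReal.ofReal_mul (by positivity)]
    exact ENNReal.ofReal_le_ofReal (failure_bound hm hβ hβ' hRN hN)
  · have hmJ : m * J = 1 := by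
      have h1 := mul_le_horizon (m := m) (J := J) hn
      have h2 : 0 < m * J := Nat.mul_pos hm hJ
      have h3 : m * J ≤ m * J * n := Nat.le_mul_of_pos_right _ hn
      omega
    have hempty : {ω : Fin (horizon n m J) → Fin m → ℝ |
        ¬ ∀ r < m * J, ∀ u, |releasedNoise (fun i => noiseAt ω i u) (r * n)| ≤ E} = ∅ := by
      refine Set.eq_empty_of_forall_notMem fun ω hω => hω fun r hr u => ?_
      obtain rfl : r = 0 := by omega
      simpa [releasedNoise] using hE0
    rw [hempty, measure_empty]
    exact zero_le

/-! ### The capacity bound -/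

/-- The power 4 collects one W from log(2m/β), a half from √log(1/δ) and 5/2 from the horizon, whose
binary logarithm is at most 3W. The constant needed is 512 · 16 = 8192, since 9√3 ≤ 16. -/
lemma capacity_bound {n m J k : ℕ} {ε δ β α : ℝ} {c : ℕ} (hn : 0 < n) (hm : 0 < m) (hJ : 0 < J)
    (hk : 0 < k) (hε : 0 < ε) (hε' : ε ≤ 1) (hδ : 0 < δ) (hδ' : δ ≤ 1 / 2) (hβ : 0 < β)
    (hβ' : β < 1) (hα : 0 < α) (hα' : α ≤ 1)
    (hc : 10000 * (√k / (α * ε)) * Real.log (n * m * J / (δ * β)) ^ 4 ≤ (c : ℝ)) :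
    2 ≤ c ∧ 2 * reserve n m J (ε * √m / (2 * √k)) δ β ≤ α * c := by
  set W := Real.log (n * m * J / (δ * β)) with hW
  have hn1 : (1 : ℝ) ≤ n := by exact_mod_cast hn
  have hm1 : (1 : ℝ) ≤ m := by exact_mod_cast hm
  have hJ1 : (1 : ℝ) ≤ J := by exact_mod_cast hJ
  have hk1 : 1 ≤ √(k : ℝ) := Real.one_le_sqrt.2 (by exact_mod_cast hk)
  have hnm : (1 : ℝ) ≤ n * m := one_le_mul_of_one_le_of_one_le hn1 hm1
  have hmnm : (m : ℝ) ≤ n * m := le_mul_of_one_le_left (by linarith) hn1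
  have hnmJ : (1 : ℝ) ≤ n * m * J := one_le_mul_of_one_le_of_one_le hnm hJ1
  have hmJ : (m : ℝ) ≤ n * m * J := hmnm.trans (le_mul_of_one_le_right (by linarith) hJ1)
  have hlog2 := Real.log_two_gt_d9
  have hΛW : Real.log (1 / δ) ≤ W := by
    refine Real.log_le_log (by positivity) ?_
    rw [div_le_div_iff₀ hδ (by positivity)]
    nlinarith
  have hΛ := half_le_log_inv hδ hδ'
  have hqW : Real.log (2 * m / β) ≤ W := by
    refine Real.log_le_log (by positivity) ?_
    rw [div_le_div_iff₀ hβ (by positivity)]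
    have : 2 * (m : ℝ) * δ ≤ n * m * J := by nlinarith
    nlinarith
  have hq0 : 0 ≤ Real.log (2 * m / β) := by
    refine Real.log_nonneg ?_
    rw [le_div_iff₀ hβ]
    nlinarith
  have hLW : Real.logb 2 (horizon n m J) ≤ 3 * W := by
    have h1 : ((horizon n m J : ℕ) : ℝ) ≤ (n * m * J) ^ 2 := by
      unfold horizon
      push_cast
      have h0 : (m : ℝ) * J ≤ (m * J) ^ 2 := by
        have : (1 : ℝ) ≤ m * J := one_le_mul_of_one_le_of_one_le hm1 hJ1
        nlinarith
      calc (n : ℝ) * (m * n * J) = n ^ 2 * (m * J) := by ring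
        _ ≤ n ^ 2 * (m * J) ^ 2 := by gcongr
        _ = _ := by ring
    have h2 : Real.log (horizon n m J) ≤ 2 * W := by
      refine (Real.log_le_log (by exact_mod_cast horizon_pos hn hm hJ) h1).trans ?_
      rw [Real.log_pow]
      push_cast
      refine mul_le_mul_of_nonneg_left (Real.log_le_log (by positivity) ?_) (by norm_num)
      rw [le_div_iff₀ (by positivity)]
      have : δ * β ≤ 1 := by nlinarith
      nlinarith
    rw [Real.logb, div_le_iff₀ (by linarith)]
    nlinarith
  have hW0 : 1 / 2 ≤ W := hΛ.trans hΛW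
  have hαε : α * ε ≤ 1 := by nlinarith
  constructor
  · have h1 : 1 ≤ √k / (α * ε) := by
      rw [le_div_iff₀ (by positivity)]
      linarith
    have h2 : (1 / 2 : ℝ) ^ 4 ≤ W ^ 4 := by gcongr
    have h3 : (2 : ℝ) ≤ c := by
      refine le_trans ?_ hc
      calc (2 : ℝ) ≤ 10000 * 1 * (1 / 2) ^ 4 := by norm_num
        _ ≤ _ := by gcongr
    exact_mod_cast h3
  · have hroot : √(Real.log (1 / δ)) * √(Real.logb 2 (horizon n m J)) ^ 5 ≤ 16 * W ^ 3 := by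
      have h1 : √(3 * W) = √3 * √W := Real.sqrt_mul (by norm_num) W
      have h2 : √W ^ 2 = W := Real.sq_sqrt (by linarith)
      have h3 : (√3 : ℝ) ^ 2 = 3 := Real.sq_sqrt (by norm_num)
      have h4 : (√3 : ℝ) ≤ 16 / 9 := by
        rw [Real.sqrt_le_left (by norm_num)]
        norm_num
      calc _ ≤ √W * √(3 * W) ^ 5 := by gcongr
        _ = √3 * (√3 ^ 2) ^ 2 * (√W ^ 2) ^ 3 := by rw [h1]; ring
        _ = √3 * 9 * W ^ 3 := by rw [h2, h3]; norm_num
        _ ≤ 16 / 9 * 9 * W ^ 3 := by gcongr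
        _ = _ := by ring
    rw [reserve_eq hm]
    calc _ = 512 * √k / ε * Real.log (2 * m / β) *
          (√(Real.log (1 / δ)) * √(Real.logb 2 (horizon n m J)) ^ 5) := by ring
      _ ≤ 512 * √k / ε * W * (16 * W ^ 3) := by gcongr
      _ = 8192 * (√k / ε * W ^ 4) := by ring
      _ ≤ 10000 * (√k / ε * W ^ 4) := by
          have : 0 ≤ √k / ε * W ^ 4 := by positivity
          linarith
      _ = α * (10000 * (√k / (α * ε)) * W ^ 4) := by field_simp
      _ ≤ α * c := by gcongr

end PrivateMatching

end

/-! ### Assembly of privacy, truthfulness and stability. -/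

theorem mainTheorem2 :
    ∃ (c : ℝ) (d : ℕ), 0 < c ∧
      ∀ (n m J k : ℕ) (ε δ β : ℝ), 0 < n → 0 < m → 0 < J → 0 < k →
        0 < ε → ε ≤ 1 → 0 < δ → δ ≤ 1 / 2 → 0 < β → β < 1 →
      ∀ (sel : PrivateMatching.SelectionRule m) (C : Fin m → ℕ),
        (∀ D : PrivateMatching.Database n m J, MeasureTheory.IsProbabilityMeasure
          (PrivateMatching.privateDA k sel C (ε * √m / (2 * √k)) δ β D)) ∧
        PrivateMatching.IsDifferentiallyPrivate
          (fun D : PrivateMatching.Database n m J =>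
            PrivateMatching.privateDA k sel C (ε * √m / (2 * √k)) δ β D) ε δ ∧
        PrivateMatching.IsApproxTruthful
          (fun D : PrivateMatching.Database n m J =>
            PrivateMatching.privateDA k sel C (ε * √m / (2 * √k)) δ β D) (ε + δ) ∧
        ∀ α : ℝ, 0 < α → α ≤ 1 →
          (∀ u, c * (√k / (α * ε)) * Real.log (n * m * J / (δ * β)) ^ d ≤ (C u : ℝ)) →
          ∀ D : PrivateMatching.Database n m J, PrivateMatching.UniqueScores D →
            (∀ a, (D a).pref.1.length ≤ k) →
            ENNReal.ofReal (1 - β) ≤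
              PrivateMatching.privateDA k sel C (ε * √m / (2 * √k)) δ β D
                {t | PrivateMatching.IsApproxStable α C D (PrivateMatching.inducedMatching D t) ∧
                  PrivateMatching.SchoolDominant C D (PrivateMatching.inducedMatching D t)} := by
  refine ⟨10000, 4, by norm_num, ?_⟩
  intro n m J k ε δ β hn hm hJ hk hε hε' hδ hδ' hβ hβ' sel C
  have hprob := fun D : PrivateMatching.Database n m J =>
    PrivateMatching.isProbabilityMeasure_privateDA k sel C (ε * √m / (2 * √k)) δ β D
  refine ⟨hprob,
    PrivateMatching.isDifferentiallyPrivate_privateDA hn hm hJ hk hε hε' hδ hδ' sel C,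
    PrivateMatching.isApproxTruthful_of_lintegral_le hδ hε hprob fun D D' h f hf =>
      PrivateMatching.lintegral_privateDA_le hn hm hJ hk hε hε' hδ hδ' sel C h f hf, ?_⟩
  intro α hα hα' hC D hD hlen
  have hcap := fun u => PrivateMatching.capacity_bound hn hm hJ hk hε hε' hδ hδ' hβ hβ' hα hα' (hC u)
  have hbad := PrivateMatching.measure_inaccurate_le hn hm hJ hk hε hδ hδ' hβ hβ'
  set μ := PrivateMatching.noiseLaw n m J
    (PrivateMatching.counterEps m (ε * √m / (2 * √k)) δ) with hμ
  rw [PrivateMatching.privateDA, Measure.map_apply (PrivateMatching.measurable_runDA k sel C _ D)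
    MeasurableSet.of_discrete]
  rw [ENNReal.ofReal_sub _ hβ.le, ENNReal.ofReal_one, tsub_le_iff_right]
  -- Every noise table either yields good thresholds or makes some counter inaccurate, and the
  -- latter has probability at most β.
  calc (1 : ENNReal) = μ Set.univ := measure_univ.symm
    _ ≤ μ (_ ∪ _) := measure_mono fun ω _ => ?_
    _ ≤ _ := (measure_union_le _ _).trans (add_le_add le_rfl hbad)
  by_cases hω : ∀ r < m * J, ∀ u, |PrivateMatching.releasedNoise
      (fun i => PrivateMatching.noiseAt ω i u) (r * n)| ≤
        PrivateMatching.reserve n m J (ε * √m / (2 * √k)) δ β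
  · exact Or.inl (PrivateMatching.runDA_good hα' (fun u => (hcap u).1)
      (fun u => (hcap u).2) hD hlen hω)
  · exact Or.inr hω
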